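/- Let $w>0$ be real and, for $p>0$, $a\in\mathbb C\setminus\{0\}$, $|\arg a|<\pi/2$, put $$S_p(a;w)=\sum_{n=1}^\infty \frac{e^{-an^p}}{n^{w}},\qquad J_p(a;w)=\begin{cases}\dfrac1p\,\Gamma\!\left(\dfrac{1-w}{p}\right)a^{(w-1)/p}, & w\ne pM+1 \text{ for all integers } M\ge 0,\\[2mm] \dfrac{(-a)^M}{M!}\left\{\gamma-\dfrac1p\log a+\dfrac1p\,\psi(M+1)\right\}, & w=pM+1 \text{ for an integer } M\ge 0,\end{cases}$$ where $\gamma$ is Euler's constant, $\psi=\Gamma'/\Gamma$, and powers and logarithms are principal. Let $\zeta$ denote the Riemann zeta function, and let $\sum'_k$ denote a sum over $k$ in which the term $k=M$ is omitted when $w=pM+1$ (no term is omitted when there is no such $M$). (i) Let $p>1$, and suppose that $w$ and $p$ are not both even integers. Then for every positive integer $N>\frac{w-1}{p}+\frac32$, $$S_p(a;w)=J_p(a;w)+\sum_{k=0}^{N-1}{}^{'}\,\frac{(-1)^k}{k!}\,\zeta(w-kp)\,a^k+O\bigl(|a|^{N-1/2}\bigr)$$ as $a\to0$ in $|\arg a|<\pi/2$,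 uniformly in every closed subsector: for every $\theta<\pi/2$ the estimate holds as $a\to0$ with $|\arg a|\le\theta$, with an implied constant depending only on $p,w,N,\theta$. (ii) Let $0<p<1$. Then for every $a\neq 0$ with $|\arg a|<\pi/2$ the series below converges (absolutely), and $$S_p(a;w)=J_p(a;w)+\sum_{k=0}^{\infty}{}^{'}\,\frac{(-1)^k}{k!}\,\zeta(w-kp)\,a^k .$$ -/

import Mathlib

open Filter Topology Asymptotics

noncomputable section

namespace SmoothedZeta

/-- The `n`-th summand, indexed from `n = 0`, of `S_p(a;w) = ∑_{n ≥ 1} exp(-a n^p) / n^w`. -/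
def summandS (p w : ℝ) (a : ℂ) (n : ℕ) : ℂ :=
  Complex.exp (-a * ((((n : ℝ) + 1) ^ p : ℝ) : ℂ)) / ((((n : ℝ) + 1) ^ w : ℝ) : ℂ)

/-- `S_p(a;w) = ∑_{n ≥ 1} exp(-a n^p) / n^w`. -/
def S (p : ℝ) (a : ℂ) (w : ℝ) : ℂ := ∑' n : ℕ, summandS p w a n

/-- The logarithmic form
`((-a)^M / M!) * (γ - (1/p) log a + (1/p) ψ(M+1))`, where `γ` is Euler's constant, `ψ` is the
logarithmic derivative of the gamma function, and `log` is the principal logarithm. -/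
def logTerm (p : ℝ) (a : ℂ) (M : ℕ) : ℂ :=
  (-a) ^ M / (M.factorial : ℂ) *
    ((Real.eulerMascheroniConstant : ℂ) - 1 / (p : ℂ) * Complex.log a
      + 1 / (p : ℂ) * Complex.digamma ((M : ℂ) + 1))

/-- The power form `(1/p) Γ((1-w)/p) a^((w-1)/p)` (principal power). -/
def powerTerm (p : ℝ) (a : ℂ) (w : ℝ) : ℂ :=
  1 / (p : ℂ) * Complex.Gamma ((((1 - w) / p : ℝ)) : ℂ) * a ^ ((((w - 1) / p : ℝ)) : ℂ)

open Classical in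
/-- `J_p(a;w)`: the logarithmic form if `w = pM + 1` for a (then unique) non-negative integer `M`,
the power form otherwise. -/
def J (p : ℝ) (a : ℂ) (w : ℝ) : ℂ :=
  if h : ∃ M : ℕ, w = p * M + 1 then logTerm p a h.choose else powerTerm p a w

/-- The `k`-th term `((-1)^k / k!) ζ(w - kp) a^k` of the primed series: the term with
`w = pk + 1`, if there is one, is omitted. -/
def primedTerm (p w : ℝ) (a : ℂ) (k : ℕ) : ℂ :=
  if w = p * k + 1 then 0
  else (-1) ^ k / (k.factorial : ℂ) * riemannZeta ((w - k * p : ℝ) : ℂ) * a ^ k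

/-- The punctured closed sector `|arg a| ≤ θ`, `a ≠ 0`. -/
def closedSector (θ : ℝ) : Set ℂ := {a : ℂ | a ≠ 0 ∧ |Complex.arg a| ≤ θ}

theorem J_of_eq {p : ℝ} (hp : p ≠ 0) (a : ℂ) {w : ℝ} {M : ℕ} (h : w = p * M + 1) :
    J p a w = logTerm p a M := by
  have hex : ∃ M : ℕ, w = p * M + 1 := ⟨M, h⟩
  have hM : hex.choose = M := by
    have h2 := hex.choose_spec
    have h3 : p * (M : ℝ) = p * (hex.choose : ℝ) := by linarith
    exact_mod_cast (mul_left_cancel₀ hp h3).symm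
  rw [J, dif_pos hex, hM]

theorem J_of_ne {p : ℝ} (a : ℂ) {w : ℝ} (h : ∀ M : ℕ, w ≠ p * M + 1) :
    J p a w = powerTerm p a w := by
  rw [J, dif_neg (by simpa using h)]

/-- The series defining `S_p(a;w)` converges absolutely in `Re a > 0`. -/
theorem summable_summandS {p w : ℝ} (hp : 0 < p) (hw : 0 < w) {a : ℂ} (ha : 0 < a.re) :
    Summable (summandS p w a) := by
  have hO : (fun t : ℝ => Real.exp (-a.re * t)) =o[atTop] fun t => t ^ (-(2 / p)) :=
    isLittleO_exp_neg_mul_rpow_atTop ha _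
  have ht : Tendsto (fun n : ℕ => ((n : ℝ) + 1) ^ p) atTop atTop :=
    (tendsto_rpow_atTop hp).comp
      (tendsto_atTop_add_const_right _ _ tendsto_natCast_atTop_atTop)
  have h1 := (hO.comp_tendsto ht).isBigO
  have hs : Summable fun n : ℕ => ((n : ℝ) + 1) ^ (-2 : ℝ) := by
    have := (summable_nat_add_iff 1).2 (Real.summable_nat_rpow.2 (by norm_num : (-2 : ℝ) < -1))
    simpa using this
  have h2 : Summable fun n : ℕ => Real.exp (-a.re * ((n : ℝ) + 1) ^ p) := by
    refine summable_of_isBigO_nat hs (h1.congr (fun _ => rfl) fun n => ?_)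
    have hn : (0 : ℝ) ≤ (n : ℝ) + 1 := by positivity
    simp only [Function.comp]
    rw [← Real.rpow_mul hn]
    congr 1
    field_simp
  refine Summable.of_norm_bounded h2 fun n => ?_
  have h1w : (1 : ℝ) ≤ ((n : ℝ) + 1) ^ w :=
    Real.one_le_rpow (by linarith [n.cast_nonneg (α := ℝ)]) hw.le
  rw [summandS, norm_div, Complex.norm_exp, Complex.norm_real, Real.norm_of_nonneg (by linarith)]
  have : (-a * ((((n : ℝ) + 1) ^ p : ℝ) : ℂ)).re = -a.re * ((n : ℝ) + 1) ^ p := by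
    rw [Complex.re_mul_ofReal, Complex.neg_re]
  rw [this]
  exact div_le_self (Real.exp_pos _).le h1w

end SmoothedZeta

end

namespace SmoothedZeta

open MeasureTheory Set

/-! Expanding exp(-a n^p) in powers of a and summing over n termwise produces divergent sums of
n^(kp-w); Euler–Maclaurin summation is what assigns them zeta values. Put f(z) = z^(-w) exp(-a z^p).
For f, the remainders over all intervals [n, n+1], n ≥ 1, add up to the regularised value (sum minus
integral over [1, ∞)) plus boundary terms at 1 (`tsum_emRem_eq`). For z^(-s) the regularised value
is ζ₀(s) = ζ(s) - 1/(s-1), and analytic continuation extends this to Re s > 1 - m for remainders of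
order m+1 (`tsum_emRem_cpow_neg`).

Remainders and boundary terms are linear in the function. Hence S - ∫_1^∞ f - ∑_{k<N} (-a)^k/k!
ζ₀(w-kp) is governed by f_N, which is f minus the first N terms of its expansion in a. Where Re(a
z^p) ≥ 0, which holds on a narrow cone about the positive axis, |f_N| ≤ |a|^N |z|^(pN-w)/N!.
Cauchy's estimate on discs of radius ρx turns this into derivative bounds, and so into the explicit
error bound `norm_S_sub_le`.

The integral and the polar parts 1/(w-kp-1) are then reassembled: under u = x^p the integral is an
upper incomplete gamma function, the polar parts sum to the lower one, and together (with γ from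
ζ₀(1) in the resonant case) they give J (`tailIntegral_add_tsum_corrTerm`).

With N and the order m fixed, the error is O(|a|^N). If p < 1, letting m grow like pN leaves a bound
of the shape C^N (m+1)!/N!, which tends to 0, so the expansion is exact. -/

/-! ### Euler–Maclaurin summation with remainder -/

/-- The Euler–Maclaurin kernel `(-1)^(m+1) B_m(t) / m!`. -/
noncomputable def emKernel (m : ℕ) (t : ℝ) : ℝ :=
  (-1) ^ (m + 1) * bernoulliFun m t / m.factorial

theorem continuous_emKernel (m : ℕ) : Continuous (emKernel m) := by
  unfold emKernel; fun_prop

/-- The sign (-1)^(m+1) is chosen for this relation: each integration by parts then passes to the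
next remainder with a plus sign. -/
theorem hasDerivAt_emKernel (m : ℕ) (t : ℝ) :
    HasDerivAt (emKernel (m + 1)) (-(emKernel m t)) t := by
  have h := ((hasDerivAt_bernoulliFun (m + 1) t).const_mul ((-1 : ℝ) ^ (m + 1 + 1))).div_const
    (((m + 1).factorial : ℕ) : ℝ)
  refine h.congr_deriv ?_
  have hm : (m.factorial : ℝ) ≠ 0 := by positivity
  have hm' : (m : ℝ) + 1 ≠ 0 := by positivity
  rw [emKernel, Nat.factorial_succ]
  push_cast
  field_simp
  ring_nf

theorem emKernel_zero_eq_one {m : ℕ} (hm : m ≠ 1) : emKernel m 0 = emKernel m 1 := by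
  rw [emKernel, emKernel, bernoulliFun_endpoints_eq_of_ne_one hm]

theorem emKernel_one (t : ℝ) : emKernel 1 t = t - 1 / 2 := by
  simp [emKernel, bernoulliFun_one]

theorem integral_emKernel {m : ℕ} (hm : m ≠ 0) : ∫ t in (0 : ℝ)..1, emKernel m t = 0 := by
  have : emKernel m = fun t => ((-1) ^ (m + 1) / m.factorial : ℝ) * bernoulliFun m t := by
    funext t; rw [emKernel]; ring
  rw [this, intervalIntegral.integral_const_mul, integral_bernoulliFun_eq_zero hm, mul_zero]

/-- A kernel of mean zero is the average of its own differences, and by induction its derivative is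
at most 1 in absolute value. -/
theorem abs_emKernel_le_one (m : ℕ) {t : ℝ} (ht : t ∈ Icc (0 : ℝ) 1) :
    |emKernel (m + 1) t| ≤ 1 := by
  induction m generalizing t with
  | zero =>
    rw [emKernel_one, abs_le]
    constructor <;> linarith [ht.1, ht.2]
  | succ m ih =>
    have hlip : ∀ s ∈ Icc (0 : ℝ) 1, |emKernel (m + 2) t - emKernel (m + 2) s| ≤ 1 := by
      intro s hs
      have h := (convex_Icc (0 : ℝ) 1).norm_image_sub_le_of_norm_hasDerivWithin_le
        (f := emKernel (m + 2)) (f' := fun x => -(emKernel (m + 1) x)) (C := 1)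
        (fun x _ => (hasDerivAt_emKernel (m + 1) x).hasDerivWithinAt)
        (fun x hx => by simpa using ih hx) hs ht
      rw [Real.norm_eq_abs, Real.norm_eq_abs] at h
      refine h.trans ?_
      rw [one_mul, abs_le]
      constructor <;> linarith [ht.1, ht.2, hs.1, hs.2]
    have hint : emKernel (m + 2) t
        = ∫ s in (0 : ℝ)..1, (emKernel (m + 2) t - emKernel (m + 2) s) := by
      rw [intervalIntegral.integral_sub (by simp)
        ((continuous_emKernel _).intervalIntegrable _ _), integral_emKernel (by omega)]
      simp
    rw [← Real.norm_eq_abs, hint]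
    refine (intervalIntegral.norm_integral_le_of_norm_le_const (C := 1) fun s hs => ?_).trans
      (by simp)
    rw [uIoc_of_le zero_le_one] at hs
    exact hlip s ⟨hs.1.le, hs.2⟩

/-- The open right half-plane. -/
def rightHalfPlane : Set ℂ := {z : ℂ | 0 < z.re}

theorem isOpen_rightHalfPlane : IsOpen rightHalfPlane :=
  isOpen_lt continuous_const Complex.continuous_re

theorem rightHalfPlane_subset_slitPlane : rightHalfPlane ⊆ Complex.slitPlane :=
  fun _ hz => Or.inl hz

theorem ofReal_mem_rightHalfPlane {x : ℝ} (hx : 0 < x) : (x : ℂ) ∈ rightHalfPlane := by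
  simpa [rightHalfPlane] using hx

theorem add_ofReal_mem_rightHalfPlane {x t : ℝ} (hx : 0 < x) (ht : t ∈ Icc (0 : ℝ) 1) :
    (x : ℂ) + t ∈ rightHalfPlane := by
  have : 0 < x + t := by linarith [ht.1]
  simpa [rightHalfPlane] using this

theorem analyticAt_of_rightHalfPlane {f : ℂ → ℂ} (hf : DifferentiableOn ℂ f rightHalfPlane)
    {z : ℂ} (hz : z ∈ rightHalfPlane) : AnalyticAt ℂ f z :=
  hf.analyticAt (isOpen_rightHalfPlane.mem_nhds hz)

theorem hasDerivAt_iteratedDeriv {f : ℂ → ℂ} (hf : DifferentiableOn ℂ f rightHalfPlane)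
    (j : ℕ) {z : ℂ} (hz : z ∈ rightHalfPlane) :
    HasDerivAt (iteratedDeriv j f) (iteratedDeriv (j + 1) f z) z := by
  rw [iteratedDeriv_succ, iteratedDeriv_eq_iterate]
  exact (AnalyticAt.iterated_deriv (analyticAt_of_rightHalfPlane hf hz) j).differentiableAt.hasDerivAt

theorem continuousOn_iteratedDeriv_add {f : ℂ → ℂ} (hf : DifferentiableOn ℂ f rightHalfPlane)
    (j : ℕ) {x : ℝ} (hx : 0 < x) :
    ContinuousOn (fun t : ℝ => iteratedDeriv j f (x + t)) (Icc 0 1) := by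
  intro t ht
  refine ContinuousAt.continuousWithinAt ?_
  have h1 : ContinuousAt (iteratedDeriv j f) ((x : ℂ) + t) :=
    (hasDerivAt_iteratedDeriv hf j (add_ofReal_mem_rightHalfPlane hx ht)).continuousAt
  exact ContinuousAt.comp (f := fun t : ℝ => (x : ℂ) + t) h1 (by fun_prop)

/-- The Euler–Maclaurin remainder of order `m` on `[x, x + 1]`. -/
noncomputable def emRem (m : ℕ) (f : ℂ → ℂ) (x : ℝ) : ℂ :=
  ∫ t in (0 : ℝ)..1, (emKernel m t : ℂ) * iteratedDeriv m f (x + t)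

theorem emRem_eq_add_emRem_succ {f : ℂ → ℂ} (hf : DifferentiableOn ℂ f rightHalfPlane)
    (m : ℕ) {x : ℝ} (hx : 0 < x) :
    emRem m f x = (emKernel (m + 1) 0 : ℂ) * iteratedDeriv m f x
      - (emKernel (m + 1) 1 : ℂ) * iteratedDeriv m f (x + 1) + emRem (m + 1) f x := by
  have hIcc : uIcc (0 : ℝ) 1 = Icc 0 1 := uIcc_of_le zero_le_one
  have hu : ∀ t ∈ uIcc (0 : ℝ) 1,
      HasDerivAt (fun t : ℝ => ((emKernel (m + 1) t : ℝ) : ℂ)) ((-(emKernel m t) : ℝ) : ℂ) t :=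
    fun t _ => (hasDerivAt_emKernel m t).ofReal_comp
  have hv : ∀ t ∈ uIcc (0 : ℝ) 1, HasDerivAt (fun t : ℝ => iteratedDeriv m f (x + t))
      (iteratedDeriv (m + 1) f (x + t)) t := by
    intro t ht
    rw [hIcc] at ht
    have h1 := hasDerivAt_iteratedDeriv hf m (add_ofReal_mem_rightHalfPlane hx ht)
    have h2 : HasDerivAt (fun t : ℝ => (x : ℂ) + t) 1 t :=
      (Complex.ofRealCLM.hasDerivAt (x := t)).const_add _
    have h3 := h1.comp_of_eq t h2 rfl
    rwa [mul_one] at h3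
  have hui : IntervalIntegrable (fun t : ℝ => ((-(emKernel m t) : ℝ) : ℂ)) volume 0 1 := by
    have := continuous_emKernel m
    exact Continuous.intervalIntegrable (by fun_prop) _ _
  have hvi : IntervalIntegrable (fun t : ℝ => iteratedDeriv (m + 1) f (x + t)) volume 0 1 :=
    ContinuousOn.intervalIntegrable (by rw [hIcc]; exact continuousOn_iteratedDeriv_add hf _ hx)
  have h := intervalIntegral.integral_mul_deriv_eq_deriv_mul hu hv hui hvi
  rw [emRem, emRem, h]
  simp only [Complex.ofReal_neg, neg_mul, intervalIntegral.integral_neg, Complex.ofReal_zero,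
    Complex.ofReal_one, add_zero]
  ring

/-- Iterated integration by parts. From the second kernel on, the endpoint values agree, so the
boundary terms are differences that telescope over consecutive intervals. -/
theorem sub_integral_eq_sum_add_emRem {f : ℂ → ℂ} (hf : DifferentiableOn ℂ f rightHalfPlane)
    (m : ℕ) {x : ℝ} (hx : 0 < x) :
    f x - ∫ t in (0 : ℝ)..1, f (x + t)
      = ∑ j ∈ Finset.range (m + 1), (-(emKernel (j + 1) 1 : ℂ)) *
          (iteratedDeriv j f (x + 1) - iteratedDeriv j f x) + emRem (m + 1) f x := by
  induction m with
  | zero =>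
    have h := emRem_eq_add_emRem_succ hf 0 hx
    -- The kernel of index 0 is the constant -1.
    have h0 : emRem 0 f x = - ∫ t in (0 : ℝ)..1, f (x + t) := by
      simp [emRem, emKernel, intervalIntegral.integral_neg]
    rw [h0] at h
    simp only [zero_add, emKernel_one, iteratedDeriv_zero] at h
    simp only [zero_add, Finset.sum_range_one, emKernel_one, iteratedDeriv_zero]
    rw [sub_eq_add_neg, h]
    push_cast
    ring
  | succ m ih =>
    rw [ih, Finset.sum_range_succ _ (m + 1), emRem_eq_add_emRem_succ hf (m + 1) hx,
      emKernel_zero_eq_one (by omega)]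
    ring

/-- `f` is bounded by `B * x ^ (-σ)` on the disc of radius `ρ * x` about every `x > 0`. -/
def ConeBound (ρ σ B : ℝ) (f : ℂ → ℂ) : Prop :=
  ∀ x : ℝ, 0 < x → ∀ z ∈ Metric.closedBall (x : ℂ) (ρ * x), ‖f z‖ ≤ B * x ^ (-σ)

theorem closedBall_subset_rightHalfPlane {ρ x : ℝ} (hρ1 : ρ < 1) (hx : 0 < x) :
    Metric.closedBall (x : ℂ) (ρ * x) ⊆ rightHalfPlane := by
  intro z hz
  rw [mem_closedBall_iff_norm] at hz
  have h1 := (Complex.abs_re_le_norm (z - x)).trans hz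
  rw [Complex.sub_re, Complex.ofReal_re, abs_le] at h1
  have : ρ * x < 1 * x := mul_lt_mul_of_pos_right hρ1 hx
  simp only [rightHalfPlane, mem_ofPred_eq]
  linarith [h1.1]

/-- Cauchy's estimate on the disc of radius ρx: each derivative gains a factor 1/x, so even a
growing function has summable remainders at high enough order. -/
theorem norm_iteratedDeriv_le {f : ℂ → ℂ} (hf : DifferentiableOn ℂ f rightHalfPlane)
    {ρ σ B : ℝ} (hρ : 0 < ρ) (hρ1 : ρ < 1) (hB : ConeBound ρ σ B f) (j : ℕ) {x : ℝ} (hx : 0 < x) :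
    ‖iteratedDeriv j f x‖ ≤ j.factorial * B / ρ ^ j * x ^ (-σ - j) := by
  have hd : DiffContOnCl ℂ f (Metric.ball (x : ℂ) (ρ * x)) := by
    refine DifferentiableOn.diffContOnCl ?_
    rw [closure_ball _ (by positivity)]
    exact hf.mono (closedBall_subset_rightHalfPlane hρ1 hx)
  have h := Complex.norm_iteratedDeriv_le_of_forall_mem_sphere_norm_le j (by positivity) hd
    (C := B * x ^ (-σ)) fun z hz => hB x hx z (Metric.sphere_subset_closedBall hz)
  refine h.trans_eq ?_
  rw [Real.rpow_sub hx, Real.rpow_natCast, mul_pow]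
  field_simp

theorem ConeBound.nonneg {ρ σ B : ℝ} {f : ℂ → ℂ} (hρ : 0 < ρ) (hB : ConeBound ρ σ B f) : 0 ≤ B := by
  have := hB 1 one_pos 1 (by simp [hρ.le])
  simp only [Real.one_rpow, mul_one] at this
  exact (norm_nonneg _).trans this

theorem norm_emRem_le {f : ℂ → ℂ} (hf : DifferentiableOn ℂ f rightHalfPlane)
    {ρ σ B : ℝ} (hρ : 0 < ρ) (hρ1 : ρ < 1) (hB : ConeBound ρ σ B f) {m : ℕ}
    (hσ : 2 ≤ σ + (m + 1 : ℕ)) {x : ℝ} (hx : 1 ≤ x) :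
    ‖emRem (m + 1) f x‖ ≤ (m + 1).factorial * B / ρ ^ (m + 1) * x ^ (-2 : ℝ) := by
  have hx0 : 0 < x := by linarith
  have hB0 := hB.nonneg hρ
  refine (intervalIntegral.norm_integral_le_of_norm_le_const
    (C := (m + 1).factorial * B / ρ ^ (m + 1) * x ^ (-2 : ℝ)) fun t ht => ?_).trans (by simp)
  rw [uIoc_of_le zero_le_one] at ht
  rw [norm_mul, Complex.norm_real, Real.norm_eq_abs]
  have h1 := abs_emKernel_le_one m ⟨ht.1.le, ht.2⟩
  have h2 := norm_iteratedDeriv_le hf hρ hρ1 hB (m + 1) (x := x + t) (by linarith [ht.1])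
  have h3 : (x + t) ^ (-σ - (m + 1 : ℕ)) ≤ x ^ (-2 : ℝ) := by
    calc (x + t) ^ (-σ - (m + 1 : ℕ)) ≤ (x + t) ^ (-2 : ℝ) :=
          Real.rpow_le_rpow_of_exponent_le (by linarith [ht.1]) (by linarith)
      _ ≤ x ^ (-2 : ℝ) :=
          Real.rpow_le_rpow_of_nonpos hx0 (by linarith [ht.1]) (by norm_num)
  push_cast at h2
  calc _ ≤ 1 * ((m + 1).factorial * B / ρ ^ (m + 1) * x ^ (-2 : ℝ)) := by
        refine mul_le_mul h1 (h2.trans ?_) (norm_nonneg _) zero_le_one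
        push_cast at h3
        exact mul_le_mul_of_nonneg_left h3 (by positivity)
    _ = _ := one_mul _

theorem hasSum_succ_rpow_neg_two : HasSum (fun n : ℕ => ((n : ℝ) + 1) ^ (-2 : ℝ)) (Real.pi ^ 2 / 6) := by
  have h := (hasSum_nat_add_iff' 1).2 hasSum_zeta_two
  simp only [Finset.sum_range_one, Nat.cast_zero, ne_eq, OfNat.ofNat_ne_zero, not_false_eq_true,
    zero_pow, div_zero, sub_zero] at h
  convert! h using 2 with n
  rw [Real.rpow_neg (by positivity)]
  norm_num

theorem tsum_succ_rpow_neg_two_le : ∑' n : ℕ, ((n : ℝ) + 1) ^ (-2 : ℝ) ≤ 2 := by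
  rw [hasSum_succ_rpow_neg_two.tsum_eq]
  nlinarith [Real.pi_lt_d2, Real.pi_gt_three]

theorem summable_emRem {f : ℂ → ℂ} (hf : DifferentiableOn ℂ f rightHalfPlane)
    {ρ σ B : ℝ} (hρ : 0 < ρ) (hρ1 : ρ < 1) (hB : ConeBound ρ σ B f) {m : ℕ}
    (hσ : 2 ≤ σ + (m + 1 : ℕ)) :
    Summable fun n : ℕ => emRem (m + 1) f ((n : ℝ) + 1) :=
  Summable.of_norm_bounded (hasSum_succ_rpow_neg_two.summable.mul_left _) fun n =>
    norm_emRem_le hf hρ hρ1 hB hσ (by linarith [n.cast_nonneg (α := ℝ)])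

theorem norm_tsum_emRem_le {f : ℂ → ℂ} (hf : DifferentiableOn ℂ f rightHalfPlane)
    {ρ σ B : ℝ} (hρ : 0 < ρ) (hρ1 : ρ < 1) (hB : ConeBound ρ σ B f) {m : ℕ}
    (hσ : 2 ≤ σ + (m + 1 : ℕ)) :
    ‖∑' n : ℕ, emRem (m + 1) f ((n : ℝ) + 1)‖ ≤ 2 * ((m + 1).factorial * B / ρ ^ (m + 1)) := by
  have hB0 := hB.nonneg hρ
  refine (tsum_of_norm_bounded (hasSum_succ_rpow_neg_two.summable.mul_left _).hasSum fun n =>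
    norm_emRem_le hf hρ hρ1 hB hσ (by linarith [n.cast_nonneg (α := ℝ)])).trans ?_
  rw [tsum_mul_left, mul_comm 2]
  exact mul_le_mul_of_nonneg_left tsum_succ_rpow_neg_two_le (by positivity)

/-- The boundary terms at `1` of the Euler–Maclaurin formula. -/
noncomputable def emBoundary (m : ℕ) (f : ℂ → ℂ) : ℂ :=
  ∑ j ∈ Finset.range m, (-(emKernel (j + 1) 1 : ℂ)) * iteratedDeriv j f 1

theorem norm_emBoundary_le {f : ℂ → ℂ} (hf : DifferentiableOn ℂ f rightHalfPlane)
    {ρ σ B : ℝ} (hρ : 0 < ρ) (hρ1 : ρ < 1) (hB : ConeBound ρ σ B f) (m : ℕ) :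
    ‖emBoundary m f‖ ≤ m * (m.factorial * B / ρ ^ m) := by
  have hB0 := hB.nonneg hρ
  refine (norm_sum_le_of_le _ (f := fun j => (-(emKernel (j + 1) 1 : ℂ)) * iteratedDeriv j f 1)
    (n := fun _ => m.factorial * B / ρ ^ m) fun j hj => ?_).trans (by simp)
  rw [norm_mul, norm_neg, Complex.norm_real, Real.norm_eq_abs]
  have h1 := abs_emKernel_le_one j (t := 1) (by simp)
  have h2 := norm_iteratedDeriv_le hf hρ hρ1 hB j one_pos
  rw [Real.one_rpow, mul_one, Complex.ofReal_one] at h2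
  have hjm : j ≤ m := (Finset.mem_range.1 hj).le
  calc _ ≤ 1 * (j.factorial * B / ρ ^ j) := mul_le_mul h1 h2 (norm_nonneg _) zero_le_one
    _ ≤ m.factorial * B / ρ ^ m := by
        rw [one_mul]
        gcongr ?_ * B / ?_
        · exact_mod_cast Nat.factorial_le hjm
        · exact pow_le_pow_of_le_one hρ.le hρ1.le hjm

/-- After telescoping, the boundary terms at X+1 vanish in the limit because σ > 0, leaving those at
1. `L` is the regularised sum. -/
theorem tsum_emRem_eq {f : ℂ → ℂ} (hf : DifferentiableOn ℂ f rightHalfPlane)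
    {ρ σ B : ℝ} (hρ : 0 < ρ) (hρ1 : ρ < 1) (hB : ConeBound ρ σ B f) (hσ0 : 0 < σ) {m : ℕ}
    (hσ : 2 ≤ σ + (m + 1 : ℕ)) {L : ℂ}
    (hL : Tendsto (fun X : ℕ => ∑ n ∈ Finset.range X,
      (f (((n : ℝ) + 1 : ℝ)) - ∫ t in (0 : ℝ)..1, f (((n : ℝ) + 1 : ℝ) + t))) atTop (𝓝 L)) :
    ∑' n : ℕ, emRem (m + 1) f ((n : ℝ) + 1) = L + emBoundary (m + 1) f := by
  have h1 := (summable_emRem hf hρ hρ1 hB hσ).hasSum.tendsto_sum_nat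
  refine tendsto_nhds_unique h1 ?_
  have hj : ∀ j : ℕ, Tendsto (fun X : ℕ => iteratedDeriv j f ((X : ℂ) + 1)) atTop (𝓝 0) := by
    intro j
    have ht : Tendsto (fun X : ℕ => (j.factorial * B / ρ ^ j) * ((X : ℝ) + 1) ^ (-(σ + j)))
        atTop (𝓝 ((j.factorial * B / ρ ^ j) * 0)) := by
      refine Tendsto.const_mul _ ?_
      exact (tendsto_rpow_neg_atTop (by positivity)).comp
        (tendsto_atTop_add_const_right _ _ tendsto_natCast_atTop_atTop)
    rw [mul_zero] at ht
    refine squeeze_zero_norm (fun X => ?_) ht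
    have := norm_iteratedDeriv_le hf hρ hρ1 hB j (x := (X : ℝ) + 1) (by positivity)
    rw [neg_add']
    simpa using this
  have hsum : Tendsto (fun X : ℕ => ∑ j ∈ Finset.range (m + 1), (-(emKernel (j + 1) 1 : ℂ)) *
      (iteratedDeriv j f ((X : ℂ) + 1) - iteratedDeriv j f 1)) atTop
      (𝓝 (∑ j ∈ Finset.range (m + 1), (-(emKernel (j + 1) 1 : ℂ)) *
      (0 - iteratedDeriv j f 1))) :=
    tendsto_finsetSum _ fun j _ => ((hj j).sub_const _).const_mul _
  have hlim := hL.sub hsum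
  have heq : L - ∑ j ∈ Finset.range (m + 1), (-(emKernel (j + 1) 1 : ℂ)) *
      (0 - iteratedDeriv j f 1) = L + emBoundary (m + 1) f := by
    rw [emBoundary, sub_eq_add_neg, ← Finset.sum_neg_distrib]
    congr 1
    exact Finset.sum_congr rfl fun j _ => by ring
  rw [heq] at hlim
  refine hlim.congr fun X => ?_
  rw [sub_eq_iff_eq_add, Finset.sum_congr rfl fun (n : ℕ) _ =>
    sub_integral_eq_sum_add_emRem hf m (x := (n : ℝ) + 1) (by positivity),
    Finset.sum_add_distrib, add_comm, Finset.sum_comm]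
  congr 1
  refine Finset.sum_congr rfl fun j _ => ?_
  rw [← Finset.mul_sum]
  congr 1
  have := Finset.sum_range_sub (fun n : ℕ => iteratedDeriv j f ((n : ℂ) + 1)) X
  simpa using this

/-! ### Zeta values from Euler–Maclaurin summation of powers -/

theorem norm_bounds_of_mem_closedBall {ρ x : ℝ} (hρ : ρ ≤ 1 / 2) (hx : 0 < x) {z : ℂ}
    (hz : z ∈ Metric.closedBall (x : ℂ) (ρ * x)) : x / 2 ≤ ‖z‖ ∧ ‖z‖ ≤ 2 * x := by
  rw [mem_closedBall_iff_norm] at hz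
  have h1 : ρ * x ≤ 1 / 2 * x := mul_le_mul_of_nonneg_right hρ hx.le
  have h2 : ‖(x : ℂ)‖ = x := by rw [Complex.norm_real, Real.norm_of_nonneg hx.le]
  have h3 := norm_sub_norm_le (x : ℂ) z
  have h4 := norm_sub_norm_le z (x : ℂ)
  rw [norm_sub_rev] at h3
  constructor <;> linarith

theorem norm_rpow_le_of_mem_closedBall {ρ x : ℝ} (hρ : ρ ≤ 1 / 2) (hx : 0 < x) {z : ℂ}
    (hz : z ∈ Metric.closedBall (x : ℂ) (ρ * x)) (σ : ℝ) :
    ‖z‖ ^ σ ≤ 2 ^ |σ| * x ^ σ := by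
  obtain ⟨h1, h2⟩ := norm_bounds_of_mem_closedBall hρ hx hz
  rcases le_total 0 σ with h | h
  · rw [abs_of_nonneg h, ← Real.mul_rpow (by norm_num) hx.le]
    exact Real.rpow_le_rpow (norm_nonneg _) h2 h
  · rw [abs_of_nonpos h, Real.rpow_neg (by norm_num), ← Real.inv_rpow (by norm_num),
      ← Real.mul_rpow (by norm_num) hx.le]
    exact Real.rpow_le_rpow_of_nonpos (by positivity) (by linarith) h

theorem differentiableOn_cpow_neg (s : ℂ) :
    DifferentiableOn ℂ (fun z : ℂ => z ^ (-s)) rightHalfPlane := fun _ hz =>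
  ((differentiableAt_id.cpow_const (rightHalfPlane_subset_slitPlane hz))).differentiableWithinAt

theorem norm_cpow_neg_le {z : ℂ} (hz : z ≠ 0) (s : ℂ) :
    ‖z ^ (-s)‖ ≤ ‖z‖ ^ (-s.re) * Real.exp (Real.pi * |s.im|) := by
  rw [Complex.norm_cpow_of_ne_zero hz, div_eq_mul_inv, ← Real.exp_neg]
  refine mul_le_mul_of_nonneg_left (Real.exp_le_exp.2 ?_) (by positivity)
  rw [Complex.neg_im, mul_neg, neg_neg]
  calc _ ≤ |z.arg * s.im| := le_abs_self _
    _ = |z.arg| * |s.im| := abs_mul _ _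
    _ ≤ _ := mul_le_mul_of_nonneg_right (Complex.abs_arg_le_pi z) (abs_nonneg _)

theorem coneBound_cpow_neg {ρ : ℝ} (hρ : ρ ≤ 1 / 2) (s : ℂ) :
    ConeBound ρ s.re (2 ^ |s.re| * Real.exp (Real.pi * |s.im|)) (fun z : ℂ => z ^ (-s)) := by
  intro x hx z hz
  have hz0 : z ≠ 0 := by
    have := (norm_bounds_of_mem_closedBall hρ hx hz).1
    exact norm_pos_iff.1 (by linarith)
  refine (norm_cpow_neg_le hz0 s).trans ?_
  have h := norm_rpow_le_of_mem_closedBall hρ hx hz (-s.re)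
  rw [abs_neg] at h
  calc _ ≤ 2 ^ |s.re| * x ^ (-s.re) * Real.exp (Real.pi * |s.im|) :=
        mul_le_mul_of_nonneg_right h (Real.exp_pos _).le
    _ = _ := by ring

theorem iteratedDeriv_cpow {z : ℂ} (hz : z ∈ rightHalfPlane) (r : ℂ) (j : ℕ) :
    iteratedDeriv j (fun z : ℂ => z ^ r) z = (∏ i ∈ Finset.range j, (r - i)) * z ^ (r - j) := by
  induction j generalizing z with
  | zero => simp
  | succ j ih =>
    rw [iteratedDeriv_succ]
    have h1 : iteratedDeriv j (fun z : ℂ => z ^ r) =ᶠ[𝓝 z]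
        fun z => (∏ i ∈ Finset.range j, (r - i)) * z ^ (r - j) := by
      filter_upwards [isOpen_rightHalfPlane.mem_nhds hz] with y hy using ih hy
    have h2 : HasDerivAt (fun z : ℂ => z ^ (r - j)) ((r - j) * z ^ (r - j - 1) * 1) z :=
      (hasDerivAt_id z).cpow_const (rightHalfPlane_subset_slitPlane hz)
    rw [h1.deriv_eq, (h2.const_mul _).deriv, Finset.prod_range_succ]
    push_cast
    rw [sub_add_eq_sub_sub]
    ring

/-- Holomorphy is in the exponent s here, as the analytic continuation requires. -/
theorem differentiable_iteratedDeriv_cpow_neg {z : ℂ} (hz : z ∈ rightHalfPlane) (j : ℕ) :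
    Differentiable ℂ fun s : ℂ => iteratedDeriv j (fun z : ℂ => z ^ (-s)) z := by
  have hz0 : z ≠ 0 := Complex.slitPlane_ne_zero (rightHalfPlane_subset_slitPlane hz)
  simp_rw [iteratedDeriv_cpow hz]
  have h1 : Differentiable ℂ fun s : ℂ => z ^ (-s - j) := fun s =>
    DifferentiableAt.const_cpow (by fun_prop) (Or.inl hz0)
  fun_prop

theorem differentiable_emBoundary_cpow_neg (m : ℕ) :
    Differentiable ℂ fun s : ℂ => emBoundary m fun z : ℂ => z ^ (-s) := by
  have h : (1 : ℂ) ∈ rightHalfPlane := by simp [rightHalfPlane]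
  unfold emBoundary
  exact Differentiable.fun_sum fun j _ =>
    (differentiable_iteratedDeriv_cpow_neg h j).const_mul _

theorem integral_cpow_neg_add {x : ℝ} (hx : 0 < x) {s : ℂ} (hs : s ≠ 1) :
    (s - 1) * ∫ t in (0 : ℝ)..1, ((x : ℂ) + t) ^ (-s)
      = (x : ℂ) ^ (1 - s) - ((x : ℂ) + 1) ^ (1 - s) := by
  have h := integral_cpow (a := x) (b := x + 1) (r := -s) (Or.inr ⟨by
    simpa using hs, by
    rw [uIcc_of_le (by linarith)]
    exact fun h0 => by linarith [h0.1]⟩)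
  have h2 := intervalIntegral.integral_comp_add_left (a := 0) (b := 1)
    (fun t : ℝ => (t : ℂ) ^ (-s)) x
  rw [add_zero] at h2
  have hs' : -s + 1 ≠ 0 := fun h0 => hs (by linear_combination -h0)
  have h3 : ∫ t in (0 : ℝ)..1, ((x : ℂ) + t) ^ (-s)
      = (((x : ℂ) + 1) ^ (1 - s) - (x : ℂ) ^ (1 - s)) / (-s + 1) := by
    have h4 := h2.trans h
    push_cast at h4
    rw [h4, neg_add_eq_sub s 1]
  rw [h3]
  field_simp
  ring

/-- The factor s - 1 clears the denominator of the integral. The right side is visibly entire in s,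
so no differentiation under the integral sign is needed. -/
theorem sub_one_mul_emRem_cpow_neg (m : ℕ) {x : ℝ} (hx : 0 < x) (s : ℂ) :
    (s - 1) * emRem (m + 1) (fun z : ℂ => z ^ (-s)) x
      = (s - 1) * (x : ℂ) ^ (-s) - ((x : ℂ) ^ (1 - s) - ((x : ℂ) + 1) ^ (1 - s))
        - (s - 1) * ∑ j ∈ Finset.range (m + 1), (-(emKernel (j + 1) 1 : ℂ)) *
          (iteratedDeriv j (fun z : ℂ => z ^ (-s)) (x + 1)
            - iteratedDeriv j (fun z : ℂ => z ^ (-s)) x) := by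
  rcases eq_or_ne s 1 with rfl | hs
  · simp
  · have h := sub_integral_eq_sum_add_emRem (differentiableOn_cpow_neg s) m hx
    rw [← integral_cpow_neg_add hx hs]
    linear_combination -(s - 1) * h

theorem differentiable_sub_one_mul_emRem_cpow_neg (m : ℕ) {x : ℝ} (hx : 0 < x) :
    Differentiable ℂ fun s : ℂ => (s - 1) * emRem (m + 1) (fun z : ℂ => z ^ (-s)) x := by
  simp_rw [sub_one_mul_emRem_cpow_neg m hx]
  have hx0 : (x : ℂ) ≠ 0 := by exact_mod_cast hx.ne'
  have hx1 : (x : ℂ) + 1 ≠ 0 := by exact_mod_cast (by positivity : x + 1 ≠ 0)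
  have h1 : Differentiable ℂ fun s : ℂ => (x : ℂ) ^ (-s) := fun s =>
    DifferentiableAt.const_cpow (by fun_prop) (Or.inl hx0)
  have h2 : Differentiable ℂ fun s : ℂ => (x : ℂ) ^ (1 - s) := fun s =>
    DifferentiableAt.const_cpow (by fun_prop) (Or.inl hx0)
  have h3 : Differentiable ℂ fun s : ℂ => ((x : ℂ) + 1) ^ (1 - s) := fun s =>
    DifferentiableAt.const_cpow (by fun_prop) (Or.inl hx1)
  have h4 : Differentiable ℂ fun s : ℂ => ∑ j ∈ Finset.range (m + 1),
      (-(emKernel (j + 1) 1 : ℂ)) * (iteratedDeriv j (fun z : ℂ => z ^ (-s)) (x + 1)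
            - iteratedDeriv j (fun z : ℂ => z ^ (-s)) x) :=
    Differentiable.fun_sum fun j _ => ((differentiable_iteratedDeriv_cpow_neg (by
      simpa using ofReal_mem_rightHalfPlane (x := x + 1) (by linarith)) j).sub
      (differentiable_iteratedDeriv_cpow_neg (ofReal_mem_rightHalfPlane hx) j)).const_mul _
  fun_prop

/-- The sums tend to ζ(s) and the integrals telescope to 1/(s-1). -/
theorem tendsto_sum_sub_integral_cpow_neg {s : ℂ} (hs : 1 < s.re) :
    Tendsto (fun X : ℕ => ∑ n ∈ Finset.range X,
      ((((n : ℝ) + 1 : ℝ) : ℂ) ^ (-s) - ∫ t in (0 : ℝ)..1, ((((n : ℝ) + 1 : ℝ) : ℂ) + t) ^ (-s)))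
      atTop (𝓝 (riemannZeta₀ s)) := by
  have hs1 : s ≠ 1 := by rintro rfl; simp at hs
  have hs1' : s - 1 ≠ 0 := sub_ne_zero.2 hs1
  have hsum : Summable fun n : ℕ => 1 / ((n : ℂ) + 1) ^ s := by
    have := (summable_nat_add_iff 1).2 (Complex.summable_one_div_nat_cpow.2 hs)
    simpa using this
  have h1 := hsum.hasSum.tendsto_sum_nat
  rw [← zeta_eq_tsum_one_div_nat_add_one_cpow hs] at h1
  have h2 : Tendsto (fun X : ℕ => (X + 1 : ℂ) ^ (1 - s)) atTop (𝓝 0) := by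
    rw [tendsto_zero_iff_norm_tendsto_zero]
    have : Tendsto (fun X : ℕ => ((X : ℝ) + 1) ^ (-(s.re - 1))) atTop (𝓝 0) :=
      (tendsto_rpow_neg_atTop (by linarith)).comp
        (tendsto_atTop_add_const_right _ _ tendsto_natCast_atTop_atTop)
    refine this.congr fun X => ?_
    have hX : (0 : ℝ) < (X : ℝ) + 1 := by positivity
    have := Complex.norm_cpow_eq_rpow_re_of_pos hX (1 - s)
    push_cast at this
    rw [this]
    simp
  have h3 := h1.sub ((h2.const_sub 1).div_const (s - 1))
  have h4 : riemannZeta s - (1 - 0) / (s - 1) = riemannZeta₀ s := by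
    rw [riemannZeta_eq_inv_sub_add hs1]; simp
  rw [h4] at h3
  refine h3.congr fun X => ?_
  rw [Finset.sum_sub_distrib]
  congr 1
  · refine Finset.sum_congr rfl fun n _ => ?_
    rw [Complex.cpow_neg, one_div]
    push_cast
    rfl
  · rw [div_eq_iff hs1', mul_comm, Finset.mul_sum]
    rw [Finset.sum_congr rfl fun (n : ℕ) _ =>
      integral_cpow_neg_add (x := (n : ℝ) + 1) (by positivity) hs1]
    have := Finset.sum_range_sub' (fun n : ℕ => ((n : ℂ) + 1) ^ (1 - s)) X
    simp only [Nat.cast_zero, zero_add, Complex.one_cpow] at this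
    rw [← this]
    push_cast
    rfl

/-- At s = 1 this is the limit of harmonic sums minus logarithms, and ζ₀(1) = γ. -/
theorem tendsto_sum_sub_integral_inv :
    Tendsto (fun X : ℕ => ∑ n ∈ Finset.range X,
      ((((n : ℝ) + 1 : ℝ) : ℂ) ^ (-1 : ℂ)
        - ∫ t in (0 : ℝ)..1, ((((n : ℝ) + 1 : ℝ) : ℂ) + t) ^ (-1 : ℂ)))
      atTop (𝓝 (riemannZeta₀ 1)) := by
  rw [riemannZeta₀_one]
  have h := (Complex.continuous_ofReal.tendsto _).comp Real.tendsto_harmonic_sub_log_add_one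
  refine h.congr fun X => ?_
  have hint : ∀ n : ℕ, ∫ t in (0 : ℝ)..1, ((((n : ℝ) + 1 : ℝ) : ℂ) + t) ^ (-1 : ℂ)
      = ((Real.log (((n + 1 : ℕ) : ℝ) + 1) - Real.log ((n : ℝ) + 1) : ℝ) : ℂ) := by
    intro n
    have hn : (0 : ℝ) < (n : ℝ) + 1 := by positivity
    have h2 := intervalIntegral.integral_comp_add_left (a := 0) (b := 1)
      (fun t : ℝ => t⁻¹) ((n : ℝ) + 1)
    rw [integral_inv_of_pos (by linarith) (by linarith), Real.log_div (by positivity) (by positivity),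
      add_zero] at h2
    push_cast at h2 ⊢
    rw [← Complex.ofReal_sub, ← h2, ← intervalIntegral.integral_ofReal]
    simp [Complex.cpow_neg_one]
  simp only [Function.comp]
  rw [Finset.sum_sub_distrib, Finset.sum_congr rfl fun n _ => hint n, ← Complex.ofReal_sum,
    Finset.sum_range_sub (fun n : ℕ => Real.log ((n : ℝ) + 1)), harmonic]
  simp [Complex.cpow_neg_one]

/-- Both sides, multiplied by s - 1, are holomorphic on a convex region and agree near 2, hence
everywhere on it. The point s = 1 is treated directly, since the factor vanishes there. -/
theorem tsum_emRem_cpow_neg (m : ℕ) {s : ℂ} (hs : 1 < s.re + m) :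
    ∑' n : ℕ, emRem (m + 1) (fun z : ℂ => z ^ (-s)) ((n : ℝ) + 1)
      = riemannZeta₀ s + emBoundary (m + 1) fun z : ℂ => z ^ (-s) := by
  rcases eq_or_ne s 1 with rfl | hs1
  · refine tsum_emRem_eq (differentiableOn_cpow_neg 1) (ρ := 1 / 2) (by norm_num) (by norm_num)
      (coneBound_cpow_neg le_rfl 1) (by simp) ?_ tendsto_sum_sub_integral_inv
    push_cast
    linarith
  -- The region is cut off by a ball containing both s and 2, so that one summable majorant serves
  -- all its points.
  set R : ℝ := ‖s‖ + 3 with hR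
  set U : Set ℂ := Metric.ball 0 R ∩ {z : ℂ | 1 - m < z.re} with hU
  have hUo : IsOpen U :=
    Metric.isOpen_ball.inter (isOpen_lt continuous_const Complex.continuous_re)
  have hUc : IsPreconnected U :=
    ((convex_ball _ _).inter (convex_halfSpace_re_gt _)).isPreconnected
  have hsU : s ∈ U := ⟨by simp [hR], by simp only [mem_ofPred_eq]; linarith⟩
  have h2U : (2 : ℂ) ∈ U := ⟨by
    simp only [Metric.mem_ball, dist_zero_right, Complex.norm_ofNat, hR]
    linarith [norm_nonneg s], by
    simp only [mem_ofPred_eq, Complex.re_ofNat]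
    linarith [m.cast_nonneg (α := ℝ)]⟩
  have hU2 : ∀ z ∈ U, 2 ≤ z.re + (m + 1 : ℕ) := fun z hz => by
    have := hz.2
    simp only [mem_ofPred_eq] at this
    push_cast
    linarith
  set B : ℝ := 2 ^ R * Real.exp (Real.pi * R)
  have hdiff : DifferentiableOn ℂ (fun s : ℂ =>
      ∑' n : ℕ, (s - 1) * emRem (m + 1) (fun z : ℂ => z ^ (-s)) ((n : ℝ) + 1)) U := by
    refine Complex.differentiableOn_tsum_of_summable_norm
      (u := fun n : ℕ => ((R + 1) * ((m + 1).factorial * B / (1 / 2) ^ (m + 1))) *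
        ((n : ℝ) + 1) ^ (-2 : ℝ))
      (hasSum_succ_rpow_neg_two.summable.mul_left _)
      (fun n => (differentiable_sub_one_mul_emRem_cpow_neg m
        (x := (n : ℝ) + 1) (by positivity)).differentiableOn) hUo ?_
    intro n z hz
    have hzR : ‖z‖ ≤ R := by simpa using (Metric.mem_ball.1 hz.1).le
    have h1 := norm_emRem_le (differentiableOn_cpow_neg z) (ρ := 1 / 2) (by norm_num)
      (by norm_num) (coneBound_cpow_neg le_rfl z) (hU2 z hz) (x := (n : ℝ) + 1)
      (by linarith [n.cast_nonneg (α := ℝ)])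
    have h2 : ‖z - 1‖ ≤ R + 1 := by
      refine (norm_sub_le _ _).trans ?_
      simpa using hzR
    have h3 : (2 : ℝ) ^ |z.re| * Real.exp (Real.pi * |z.im|) ≤ B := by
      refine mul_le_mul ?_ ?_ (by positivity) (by positivity)
      · exact Real.rpow_le_rpow_of_exponent_le (by norm_num) ((Complex.abs_re_le_norm z).trans hzR)
      · exact Real.exp_le_exp.2 (mul_le_mul_of_nonneg_left
          ((Complex.abs_im_le_norm z).trans hzR) Real.pi_pos.le)
    rw [norm_mul, mul_assoc (R + 1)]
    refine mul_le_mul h2 (h1.trans ?_) (norm_nonneg _) (by positivity)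
    gcongr
  have hdiff2 : DifferentiableOn ℂ (fun s : ℂ =>
      (s - 1) * (riemannZeta₀ s + emBoundary (m + 1) fun z : ℂ => z ^ (-s))) U := by
    have := differentiable_emBoundary_cpow_neg (m + 1)
    exact Differentiable.differentiableOn (by fun_prop)
  have hev : (fun s : ℂ =>
      ∑' n : ℕ, (s - 1) * emRem (m + 1) (fun z : ℂ => z ^ (-s)) ((n : ℝ) + 1)) =ᶠ[𝓝 2]
      fun s => (s - 1) * (riemannZeta₀ s + emBoundary (m + 1) fun z : ℂ => z ^ (-s)) := by
    have hmem : {z : ℂ | 1 < z.re} ∈ 𝓝 (2 : ℂ) :=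
      (isOpen_lt continuous_const Complex.continuous_re).mem_nhds (by simp)
    filter_upwards [hmem, hUo.mem_nhds h2U] with z hz hzU
    rw [tsum_mul_left, tsum_emRem_eq (differentiableOn_cpow_neg z) (ρ := 1 / 2) (by norm_num)
      (by norm_num) (coneBound_cpow_neg le_rfl z) (by linarith) (hU2 z hzU)
      (tendsto_sum_sub_integral_cpow_neg hz)]
  have heq := (hdiff.analyticOnNhd hUo).eqOn_of_preconnected_of_eventuallyEq
    (hdiff2.analyticOnNhd hUo) hUc h2U hev hsU
  refine mul_left_cancel₀ (sub_ne_zero.2 hs1) ?_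
  rw [← tsum_mul_left]
  exact heq

/-! ### Taylor remainders of the exponential in the right half-plane -/

/-- The Taylor remainder of order `N` of `exp (-u)` at `0`. -/
noncomputable def expTaylorRem (N : ℕ) (u : ℂ) : ℂ :=
  Complex.exp (-u) - ∑ k ∈ Finset.range N, (-u) ^ k / (k.factorial : ℂ)

theorem differentiable_expTaylorRem (N : ℕ) : Differentiable ℂ (expTaylorRem N) := by
  unfold expTaylorRem
  fun_prop

theorem hasDerivAt_expTaylorRem_succ (N : ℕ) (u : ℂ) :
    HasDerivAt (expTaylorRem (N + 1)) (-expTaylorRem N u) u := by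
  have h1 : HasDerivAt (fun u : ℂ => Complex.exp (-u)) (-Complex.exp (-u)) u := by
    simpa using (hasDerivAt_id u).neg.cexp
  have h2 : HasDerivAt (fun u : ℂ => ∑ k ∈ Finset.range (N + 1), (-u) ^ k / (k.factorial : ℂ))
      (-∑ k ∈ Finset.range N, (-u) ^ k / (k.factorial : ℂ)) u := by
    have : HasDerivAt (fun u : ℂ => ∑ k ∈ Finset.range (N + 1), (-u) ^ k / (k.factorial : ℂ))
      (∑ k ∈ Finset.range (N + 1), (k * (-u) ^ (k - 1) * (-1)) / (k.factorial : ℂ)) u :=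
      HasDerivAt.fun_sum fun k _ => (((hasDerivAt_id u).neg).pow k).div_const _
    refine this.congr_deriv ?_
    rw [Finset.sum_range_succ', ← Finset.sum_neg_distrib]
    simp only [Nat.cast_zero, zero_mul, zero_div, add_zero]
    refine Finset.sum_congr rfl fun k _ => ?_
    rw [Nat.factorial_succ, Nat.add_sub_cancel]
    have : (k.factorial : ℂ) ≠ 0 := by exact_mod_cast k.factorial_ne_zero
    have h' : (k : ℂ) + 1 ≠ 0 := by exact_mod_cast k.succ_ne_zero
    push_cast
    field_simp
  refine (h1.sub h2).congr_deriv ?_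
  rw [expTaylorRem]
  ring

/-- Since |exp(-u)| ≤ 1 for Re u ≥ 0, integrating along the segment from 0 to u raises the order by
one without an exponential factor. -/
theorem norm_expTaylorRem_le (N : ℕ) {u : ℂ} (hu : 0 ≤ u.re) :
    ‖expTaylorRem N u‖ ≤ ‖u‖ ^ N / N.factorial := by
  induction N generalizing u with
  | zero =>
    simp only [expTaylorRem, Finset.range_zero, Finset.sum_empty, sub_zero, Complex.norm_exp]
    simpa using hu
  | succ N ih =>
    have hd : ∀ t : ℝ, HasDerivAt (fun t : ℝ => expTaylorRem (N + 1) (t * u))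
        (-expTaylorRem N (t * u) * u) t := by
      intro t
      have h2 : HasDerivAt (fun t : ℝ => (t : ℂ) * u) (1 * u) t :=
        (Complex.ofRealCLM.hasDerivAt (x := t)).mul_const u
      have h3 := (hasDerivAt_expTaylorRem_succ N (t * u)).comp_of_eq t h2 rfl
      rwa [one_mul] at h3
    have hB : ∀ t : ℝ, HasDerivAt (fun t : ℝ => ‖u‖ ^ (N + 1) / (N + 1).factorial * t ^ (N + 1))
        (‖u‖ ^ (N + 1) / N.factorial * t ^ N) t := by
      intro t
      refine ((hasDerivAt_pow (N + 1) t).const_mul _).congr_deriv ?_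
      rw [Nat.factorial_succ, Nat.add_sub_cancel]
      have : (N.factorial : ℝ) ≠ 0 := by positivity
      have h' : (N : ℝ) + 1 ≠ 0 := by positivity
      push_cast
      field_simp
    have h := image_norm_le_of_norm_deriv_right_le_deriv_boundary (a := 0) (b := 1)
      (fun t _ => (hd t).continuousAt.continuousWithinAt)
      (fun t _ => (hd t).hasDerivWithinAt) (B := _) ?_ hB ?_ (x := 1) (by simp)
    · simpa using h
    · simp [expTaylorRem, Finset.sum_range_succ']
    · intro t ht
      have hre : 0 ≤ ((t : ℂ) * u).re := by
        rw [Complex.re_ofReal_mul]; exact mul_nonneg ht.1 hu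
      rw [norm_mul, norm_neg]
      refine (mul_le_mul_of_nonneg_right (ih hre) (norm_nonneg _)).trans_eq ?_
      rw [norm_mul, Complex.norm_real, Real.norm_of_nonneg ht.1]
      ring

/-! ### The summand as a holomorphic function -/

/-- For `|arg a| ≤ θ < π/2` the number `a z ^ p` stays in the closed right half-plane
on a cone about the positive real axis. -/
theorem exists_cone_re_nonneg {p θ : ℝ} (hp : 0 < p) (hθ : θ < Real.pi / 2) :
    ∃ ρ : ℝ, 0 < ρ ∧ ρ ≤ 1 / 2 ∧ ∀ a : ℂ, a ≠ 0 → |a.arg| ≤ θ → ∀ x : ℝ, 0 < x →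
      ∀ z ∈ Metric.closedBall (x : ℂ) (ρ * x), 0 ≤ (a * z ^ (p : ℂ)).re := by
  -- The aperture is such that p|arg z| uses up at most the margin π/2 - θ.
  have hδ : 0 < (Real.pi / 2 - θ) / p := div_pos (by linarith) hp
  have hcont : ContinuousAt Complex.arg 1 := Complex.continuousAt_arg (by simp)
  obtain ⟨ε, hε, hball⟩ := Metric.continuousAt_iff.1 hcont _ hδ
  refine ⟨min (ε / 2) (1 / 2), by positivity, min_le_right _ _, ?_⟩
  intro a ha harg x hx z hz
  have hz0 : z ≠ 0 := by
    have := (norm_bounds_of_mem_closedBall (min_le_right _ _) hx hz).1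
    exact norm_pos_iff.1 (by linarith)
  have hx0 : (x : ℂ) ≠ 0 := by exact_mod_cast hx.ne'
  have hzarg : |z.arg| < (Real.pi / 2 - θ) / p := by
    have hd : dist (z / x) 1 < ε := by
      rw [mem_closedBall_iff_norm] at hz
      rw [dist_eq_norm, div_sub_one hx0, norm_div, Complex.norm_real, Real.norm_of_nonneg hx.le,
        div_lt_iff₀ hx]
      refine hz.trans_lt (mul_lt_mul_of_pos_right ?_ hx)
      exact (min_le_left _ _).trans_lt (by linarith)
    have h := hball hd
    rw [Complex.arg_one, dist_zero_right, Real.norm_eq_abs] at h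
    have h2 : z.arg = (z / x).arg := by
      rw [← Complex.arg_real_mul (z / x) hx, mul_div_cancel₀ _ hx0]
    rwa [h2]
  rw [Complex.cpow_def_of_ne_zero hz0]
  nth_rw 1 [← Complex.exp_log ha]
  rw [← Complex.exp_add, Complex.exp_re]
  refine mul_nonneg (Real.exp_pos _).le (Real.cos_nonneg_of_mem_Icc ?_)
  have him : (Complex.log a + Complex.log z * p).im = a.arg + z.arg * p := by
    rw [Complex.add_im, Complex.im_mul_ofReal, Complex.log_im, Complex.log_im]
  rw [him]
  have h3 : |a.arg + z.arg * p| ≤ Real.pi / 2 := by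
    refine (abs_add_le _ _).trans ?_
    rw [abs_mul, abs_of_pos hp]
    have := (lt_div_iff₀ hp).1 hzarg
    linarith
  exact ⟨by linarith [(abs_le.1 h3).1], (abs_le.1 h3).2⟩

/-- `z ^ (-w) * exp (-a z ^ p)`. -/
noncomputable def expFun (p w : ℝ) (a z : ℂ) : ℂ :=
  z ^ (-(w : ℂ)) * Complex.exp (-(a * z ^ (p : ℂ)))

/-- `z ^ (-w)` times the Taylor remainder of order `N` of `exp (-a z ^ p)` in powers of `a`. -/
noncomputable def expFunRem (p w : ℝ) (N : ℕ) (a z : ℂ) : ℂ :=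
  z ^ (-(w : ℂ)) * expTaylorRem N (a * z ^ (p : ℂ))

theorem expFunRem_zero (p w : ℝ) (a : ℂ) : expFunRem p w 0 a = expFun p w a := by
  funext z
  simp [expFunRem, expFun, expTaylorRem]

theorem differentiableOn_expFunRem (p w : ℝ) (N : ℕ) (a : ℂ) :
    DifferentiableOn ℂ (expFunRem p w N a) rightHalfPlane := by
  intro z hz
  have hz' := rightHalfPlane_subset_slitPlane hz
  have h1 : DifferentiableAt ℂ (fun z : ℂ => z ^ (-(w : ℂ))) z :=
    differentiableAt_id.cpow_const hz'
  have h2 : DifferentiableAt ℂ (fun z : ℂ => a * z ^ (p : ℂ)) z :=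
    (differentiableAt_id.cpow_const hz').const_mul a
  exact (h1.mul (((differentiable_expTaylorRem N) _).comp z h2)).differentiableWithinAt

/-- The exponent w - pN may be negative. The factor 1/N! is kept because the convergent case depends
on it. -/
theorem coneBound_expFunRem {p w ρ : ℝ} {a : ℂ} (hρ : ρ ≤ 1 / 2)
    (hre : ∀ x : ℝ, 0 < x → ∀ z ∈ Metric.closedBall (x : ℂ) (ρ * x), 0 ≤ (a * z ^ (p : ℂ)).re)
    (N : ℕ) :
    ConeBound ρ (w - p * N) (2 ^ |p * N - w| * (‖a‖ ^ N / N.factorial)) (expFunRem p w N a) := by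
  intro x hx z hz
  have hz0 : 0 < ‖z‖ := by
    have := (norm_bounds_of_mem_closedBall hρ hx hz).1
    linarith
  rw [expFunRem, norm_mul]
  have h1 : ‖z ^ (-(w : ℂ))‖ = ‖z‖ ^ (-w) := by
    rw [← Complex.ofReal_neg, Complex.norm_cpow_real]
  have h2 := norm_expTaylorRem_le N (hre x hx z hz)
  rw [norm_mul, Complex.norm_cpow_real, mul_pow, ← Real.rpow_mul_natCast (norm_nonneg _)] at h2
  rw [h1]
  have h3 := norm_rpow_le_of_mem_closedBall hρ hx hz (p * N - w)
  rw [neg_sub]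
  calc ‖z‖ ^ (-w) * ‖expTaylorRem N (a * z ^ (p : ℂ))‖
      ≤ ‖z‖ ^ (-w) * (‖a‖ ^ N * ‖z‖ ^ (p * N) / N.factorial) :=
        mul_le_mul_of_nonneg_left h2 (by positivity)
    _ = (‖a‖ ^ N / N.factorial) * ‖z‖ ^ (p * N - w) := by
        rw [sub_eq_add_neg, Real.rpow_add hz0]; ring
    _ ≤ (‖a‖ ^ N / N.factorial) * (2 ^ |p * N - w| * x ^ (p * N - w)) :=
        mul_le_mul_of_nonneg_left h3 (by positivity)
    _ = _ := by ring

theorem expFunRem_eq {p w : ℝ} {N : ℕ} {a z : ℂ} (hz : z ≠ 0) :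
    expFunRem p w N a z = expFunRem p w 0 a z
      - ∑ k ∈ Finset.range N, ((-a) ^ k / (k.factorial : ℂ)) * z ^ (-((w - k * p : ℝ) : ℂ)) := by
  simp only [expFunRem, expTaylorRem, Finset.range_zero, Finset.sum_empty, sub_zero]
  rw [mul_sub, Finset.mul_sum]
  congr 1
  refine Finset.sum_congr rfl fun k _ => ?_
  have h : z ^ (-((w - k * p : ℝ) : ℂ)) = z ^ (-(w : ℂ)) * (z ^ (p : ℂ)) ^ k := by
    rw [← Complex.cpow_nat_mul, ← Complex.cpow_add _ _ hz]
    congr 1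
    push_cast
    ring
  rw [h, ← neg_mul, mul_pow]
  ring

theorem iteratedDeriv_expFunRem (p w : ℝ) (N : ℕ) (a : ℂ) (j : ℕ) {z : ℂ}
    (hz : z ∈ rightHalfPlane) :
    iteratedDeriv j (expFunRem p w N a) z = iteratedDeriv j (expFunRem p w 0 a) z
      - ∑ k ∈ Finset.range N, ((-a) ^ k / (k.factorial : ℂ)) *
        iteratedDeriv j (fun z : ℂ => z ^ (-((w - k * p : ℝ) : ℂ))) z := by
  have h1 : expFunRem p w N a =ᶠ[𝓝 z] (expFunRem p w 0 a - fun z : ℂ =>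
      ∑ k ∈ Finset.range N, ((-a) ^ k / (k.factorial : ℂ)) * z ^ (-((w - k * p : ℝ) : ℂ))) := by
    filter_upwards [isOpen_rightHalfPlane.mem_nhds hz] with y hy
    rw [expFunRem_eq (Complex.slitPlane_ne_zero (rightHalfPlane_subset_slitPlane hy))]
    rfl
  have h2 : ContDiffAt ℂ j (expFunRem p w 0 a) z :=
    (analyticAt_of_rightHalfPlane (differentiableOn_expFunRem p w 0 a) hz).contDiffAt
  have h3 : ∀ k : ℕ, ContDiffAt ℂ j (fun z : ℂ => z ^ (-((w - k * p : ℝ) : ℂ))) z := fun k =>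
    (analyticAt_of_rightHalfPlane (differentiableOn_cpow_neg _) hz).contDiffAt
  have h4 : ∀ k ∈ Finset.range N, ContDiffAt ℂ j
      (fun z : ℂ => ((-a) ^ k / (k.factorial : ℂ)) * z ^ (-((w - k * p : ℝ) : ℂ))) z :=
    fun k _ => contDiffAt_const.mul (h3 k)
  rw [h1.iteratedDeriv_eq, iteratedDeriv_sub h2 (ContDiffAt.sum h4), iteratedDeriv_fun_sum h4]
  congr 1
  exact Finset.sum_congr rfl fun k _ => iteratedDeriv_const_mul _ (h3 k)

theorem emRem_expFunRem (p w : ℝ) (N : ℕ) (a : ℂ) (m : ℕ) {x : ℝ} (hx : 0 < x) :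
    emRem m (expFunRem p w N a) x = emRem m (expFunRem p w 0 a) x
      - ∑ k ∈ Finset.range N, ((-a) ^ k / (k.factorial : ℂ)) *
        emRem m (fun z : ℂ => z ^ (-((w - k * p : ℝ) : ℂ))) x := by
  have hint : ∀ f : ℂ → ℂ, DifferentiableOn ℂ f rightHalfPlane → IntervalIntegrable
      (fun t : ℝ => (emKernel m t : ℂ) * iteratedDeriv m f (x + t)) volume 0 1 := by
    intro f hf
    refine ContinuousOn.intervalIntegrable ?_
    rw [uIcc_of_le zero_le_one]
    exact (Complex.continuous_ofReal.comp (continuous_emKernel m)).continuousOn.mul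
      (continuousOn_iteratedDeriv_add hf m hx)
  simp only [emRem]
  simp_rw [← intervalIntegral.integral_const_mul]
  rw [← intervalIntegral.integral_finsetSum fun k _ =>
    (hint _ (differentiableOn_cpow_neg _)).const_mul _,
    ← intervalIntegral.integral_sub (hint _ (differentiableOn_expFunRem p w 0 a)) (by
      simpa only [Finset.sum_fn] using IntervalIntegrable.sum (Finset.range N) fun (k : ℕ) _ =>
        (hint _ (differentiableOn_cpow_neg ((w - k * p : ℝ) : ℂ))).const_mul
          ((-a) ^ k / (k.factorial : ℂ)))]
  refine intervalIntegral.integral_congr fun t ht => ?_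
  rw [uIcc_of_le zero_le_one] at ht
  rw [iteratedDeriv_expFunRem p w N a m (add_ofReal_mem_rightHalfPlane hx ht), mul_sub,
    Finset.mul_sum]
  congr 1
  exact Finset.sum_congr rfl fun k _ => by ring

theorem emBoundary_expFunRem (p w : ℝ) (N : ℕ) (a : ℂ) (m : ℕ) :
    emBoundary m (expFunRem p w N a) = emBoundary m (expFunRem p w 0 a)
      - ∑ k ∈ Finset.range N, ((-a) ^ k / (k.factorial : ℂ)) *
        emBoundary m (fun z : ℂ => z ^ (-((w - k * p : ℝ) : ℂ))) := by
  have h1 : (1 : ℂ) ∈ rightHalfPlane := by simp [rightHalfPlane]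
  simp only [emBoundary, iteratedDeriv_expFunRem p w N a _ h1, Finset.mul_sum, mul_sub,
    Finset.sum_sub_distrib]
  rw [Finset.sum_comm]
  congr 1
  exact Finset.sum_congr rfl fun k _ => Finset.sum_congr rfl fun j _ => by ring

/-! ### The expansion with explicit error bound -/

theorem expFun_ofReal (p w : ℝ) (a : ℂ) {x : ℝ} (hx : 0 ≤ x) :
    expFun p w a x = Complex.exp (-a * ((x ^ p : ℝ) : ℂ)) / ((x ^ w : ℝ) : ℂ) := by
  rw [expFun, Complex.cpow_neg, Complex.ofReal_cpow hx, Complex.ofReal_cpow hx, neg_mul,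
    div_eq_inv_mul]

theorem continuousOn_expFun (p w : ℝ) (a : ℂ) :
    ContinuousOn (fun x : ℝ => expFun p w a x) (Ioi 0) := by
  intro x hx
  have h := (differentiableOn_expFunRem p w 0 a).continuousOn.continuousAt
    (isOpen_rightHalfPlane.mem_nhds (ofReal_mem_rightHalfPlane hx))
  rw [expFunRem_zero] at h
  exact (ContinuousAt.comp (f := fun x : ℝ => (x : ℂ)) h
    Complex.continuous_ofReal.continuousAt).continuousWithinAt

theorem integrableOn_expFun {p w : ℝ} (hp : 0 < p) (hw : 0 < w) {a : ℂ} (ha : 0 < a.re) :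
    IntegrableOn (fun x : ℝ => expFun p w a x) (Ioi 1) := by
  have h := (integrableOn_rpow_mul_exp_neg_mul_rpow (s := 0) (by norm_num) hp ha).mono_set
    (Ioi_subset_Ioi zero_le_one)
  refine Integrable.mono' h (((continuousOn_expFun p w a).mono
    (Ioi_subset_Ioi zero_le_one)).aestronglyMeasurable measurableSet_Ioi) ?_
  refine (ae_restrict_iff' measurableSet_Ioi).2 (Eventually.of_forall fun x hx => ?_)
  have hx1 : (1 : ℝ) < x := hx
  have h1w : (1 : ℝ) ≤ x ^ w := Real.one_le_rpow hx1.le hw.le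
  rw [expFun_ofReal p w a (by linarith), norm_div, Complex.norm_exp, Complex.norm_real,
    Real.norm_of_nonneg (by linarith), Complex.re_mul_ofReal, Complex.neg_re, Real.rpow_zero,
    one_mul]
  exact div_le_self (Real.exp_pos _).le h1w

/-- The integral `∫_1^∞ x ^ (-w) exp (-a x ^ p) dx`. -/
noncomputable def tailIntegral (p w : ℝ) (a : ℂ) : ℂ := ∫ x in Ioi (1 : ℝ), expFun p w a x

theorem tendsto_sum_sub_integral_expFun {p w : ℝ} (hp : 0 < p) (hw : 0 < w) {a : ℂ}
    (ha : 0 < a.re) :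
    Tendsto (fun X : ℕ => ∑ n ∈ Finset.range X, (expFun p w a (((n : ℝ) + 1 : ℝ))
      - ∫ t in (0 : ℝ)..1, expFun p w a (((n : ℝ) + 1 : ℝ) + t)))
      atTop (𝓝 (S p a w - tailIntegral p w a)) := by
  have h1 := (summable_summandS hp hw ha).hasSum.tendsto_sum_nat
  have h2 : Tendsto (fun X : ℕ => ∫ x in (1 : ℝ)..((X : ℝ) + 1), expFun p w a x) atTop
      (𝓝 (tailIntegral p w a)) :=
    intervalIntegral_tendsto_integral_Ioi 1 (integrableOn_expFun hp hw ha)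
      (tendsto_atTop_add_const_right _ _ tendsto_natCast_atTop_atTop)
  refine (h1.sub h2).congr fun X => ?_
  rw [Finset.sum_sub_distrib]
  congr 1
  · refine Finset.sum_congr rfl fun n _ => ?_
    rw [expFun_ofReal p w a (by positivity), summandS]
  · have hii : ∀ k < X, IntervalIntegrable (fun x : ℝ => expFun p w a x) volume
        ((k : ℝ) + 1) (((k + 1 : ℕ) : ℝ) + 1) := by
      intro k _
      refine ContinuousOn.intervalIntegrable ((continuousOn_expFun p w a).mono ?_)
      intro x hx
      rw [uIcc_of_le (by push_cast; linarith)] at hx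
      exact lt_of_lt_of_le (by positivity) hx.1
    have h := intervalIntegral.sum_integral_adjacent_intervals
      (a := fun k : ℕ => (k : ℝ) + 1) hii
    simp only [Nat.cast_zero, zero_add] at h
    rw [← h]
    refine Finset.sum_congr rfl fun n _ => ?_
    have h3 := intervalIntegral.integral_comp_add_left (a := 0) (b := 1)
      (fun t : ℝ => expFun p w a t) ((n : ℝ) + 1)
    rw [add_zero] at h3
    push_cast at h3 ⊢
    rw [← h3]

/-- The bound is explicit in N and m, so it serves both for fixed N and for N → ∞. In m + 3, the
remainder sum accounts for 2 and the boundary terms for m + 1. -/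
theorem norm_S_sub_le {p w ρ : ℝ} (hp : 0 < p) (hw : 0 < w) {a : ℂ} (ha : 0 < a.re)
    (hρ0 : 0 < ρ) (hρ : ρ ≤ 1 / 2)
    (hre : ∀ x : ℝ, 0 < x → ∀ z ∈ Metric.closedBall (x : ℂ) (ρ * x), 0 ≤ (a * z ^ (p : ℂ)).re)
    {N m : ℕ} (hm : 1 ≤ w - p * N + m) :
    ‖S p a w - tailIntegral p w a - ∑ k ∈ Finset.range N,
        ((-a) ^ k / (k.factorial : ℂ)) * riemannZeta₀ ((w - k * p : ℝ) : ℂ)‖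
      ≤ (m + 3) * ((m + 1).factorial * (2 ^ |p * N - w| * (‖a‖ ^ N / N.factorial))
          / ρ ^ (m + 1)) := by
  have hρ1 : ρ < 1 := by linarith
  have hcone := coneBound_expFunRem (w := w) hρ hre
  have hdiff := differentiableOn_expFunRem p w
  have hmN : 2 ≤ (w - p * N) + (m + 1 : ℕ) := by push_cast; linarith
  have hpN : 0 ≤ p * N := by positivity
  have hm0 : 2 ≤ (w - p * (0 : ℕ)) + (m + 1 : ℕ) := by push_cast; linarith
  have hk : ∀ k ∈ Finset.range N, 1 < w - k * p + m := fun k hk => by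
    have h1 : (k : ℝ) < N := by exact_mod_cast Finset.mem_range.1 hk
    have := mul_lt_mul_of_pos_right h1 hp
    linarith
  have hL := tendsto_sum_sub_integral_expFun hp hw ha
  rw [← expFunRem_zero] at hL
  have hsum0 := tsum_emRem_eq (hdiff 0 a) hρ0 hρ1 (hcone 0) (by simpa using hw) hm0 hL
  have hsk : ∀ k ∈ Finset.range N, ∑' n : ℕ,
      emRem (m + 1) (fun z : ℂ => z ^ (-((w - k * p : ℝ) : ℂ))) ((n : ℝ) + 1)
      = riemannZeta₀ ((w - k * p : ℝ) : ℂ)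
        + emBoundary (m + 1) fun z : ℂ => z ^ (-((w - k * p : ℝ) : ℂ)) := fun k hkN =>
    tsum_emRem_cpow_neg m (by simpa only [Complex.ofReal_re] using hk k hkN)
  have hsummk : ∀ k ∈ Finset.range N, Summable fun n : ℕ => ((-a) ^ k / (k.factorial : ℂ)) *
      emRem (m + 1) (fun z : ℂ => z ^ (-((w - k * p : ℝ) : ℂ))) ((n : ℝ) + 1) := fun k hkN =>
    (summable_emRem (differentiableOn_cpow_neg _) hρ0 hρ1 (coneBound_cpow_neg hρ _) (by
      have := hk k hkN
      rw [Complex.ofReal_re]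
      push_cast
      linarith)).mul_left _
  have hsumm0 := summable_emRem (hdiff 0 a) hρ0 hρ1 (hcone 0) hm0
  -- `tsum_emRem_eq` is not applied to the N-th remainder function, whose exponent need not be
  -- positive; its remainders are split by linearity into those of f and of pure powers.
  have htot : ∑' n : ℕ, emRem (m + 1) (expFunRem p w N a) ((n : ℝ) + 1)
      = (S p a w - tailIntegral p w a - ∑ k ∈ Finset.range N,
        ((-a) ^ k / (k.factorial : ℂ)) * riemannZeta₀ ((w - k * p : ℝ) : ℂ))
        + emBoundary (m + 1) (expFunRem p w N a) := by
    rw [tsum_congr fun n : ℕ => emRem_expFunRem p w N a (m + 1) (x := (n : ℝ) + 1) (by positivity),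
      hsumm0.tsum_sub (summable_sum hsummk), hsum0, Summable.tsum_finsetSum hsummk,
      emBoundary_expFunRem p w N a, Finset.sum_congr rfl fun k hkN => by
        rw [tsum_mul_left, hsk k hkN]]
    simp only [mul_add, Finset.sum_add_distrib]
    ring
  have h1 := norm_tsum_emRem_le (hdiff N a) hρ0 hρ1 (hcone N) hmN
  have h2 := norm_emBoundary_le (hdiff N a) hρ0 hρ1 (hcone N) (m + 1)
  rw [eq_sub_of_add_eq htot.symm]
  refine (norm_sub_le _ _).trans ((add_le_add h1 h2).trans_eq ?_)
  push_cast
  ring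

/-! ### The incomplete gamma function with complex rate -/

/-- `u ^ (s - 1) * exp (-a u)`. -/
noncomputable def gammaIntegrand (s : ℝ) (a : ℂ) (u : ℝ) : ℂ :=
  ((u ^ (s - 1) : ℝ) : ℂ) * Complex.exp (-a * u)

theorem norm_gammaIntegrand (s : ℝ) (a : ℂ) {u : ℝ} (hu : 0 ≤ u) :
    ‖gammaIntegrand s a u‖ = u ^ (s - 1) * Real.exp (-a.re * u) := by
  rw [gammaIntegrand, norm_mul, Complex.norm_real, Real.norm_of_nonneg (by positivity),
    Complex.norm_exp, Complex.re_mul_ofReal, Complex.neg_re]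

theorem continuousOn_gammaIntegrand (s : ℝ) (a : ℂ) :
    ContinuousOn (gammaIntegrand s a) (Ioi 0) := by
  have h : ContinuousOn (fun u : ℝ => u ^ (s - 1)) (Ioi 0) := fun u hu =>
    (Real.continuousAt_rpow_const u _ (Or.inl (ne_of_gt hu))).continuousWithinAt
  unfold gammaIntegrand
  exact (Complex.continuous_ofReal.comp_continuousOn h).mul (by fun_prop)

theorem integrableOn_rpow_mul_exp_neg {r b : ℝ} (hr : -1 < r) (hb : 0 < b) :
    IntegrableOn (fun u : ℝ => u ^ r * Real.exp (-b * u)) (Ioi 0) := by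
  simpa using integrableOn_rpow_mul_exp_neg_mul_rpow hr one_pos hb

theorem integrableOn_gammaIntegrand_Ioi_zero {s : ℝ} (hs : 0 < s) {a : ℂ} (ha : 0 < a.re) :
    IntegrableOn (gammaIntegrand s a) (Ioi 0) := by
  refine Integrable.mono' (integrableOn_rpow_mul_exp_neg (r := s - 1) (by linarith) ha)
    ((continuousOn_gammaIntegrand s a).aestronglyMeasurable measurableSet_Ioi) ?_
  refine (ae_restrict_iff' measurableSet_Ioi).2 (Eventually.of_forall fun u hu => ?_)
  exact (norm_gammaIntegrand s a (le_of_lt hu)).le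

theorem integrableOn_gammaIntegrand_Ioi_one (s : ℝ) {a : ℂ} (ha : 0 < a.re) :
    IntegrableOn (gammaIntegrand s a) (Ioi 1) := by
  have h01 : Ioi (1 : ℝ) ⊆ Ioi 0 := Ioi_subset_Ioi zero_le_one
  refine Integrable.mono' ((integrableOn_rpow_mul_exp_neg (r := max (s - 1) 0)
    (by linarith [le_max_right (s - 1) 0]) ha).mono_set h01)
    (((continuousOn_gammaIntegrand s a).mono h01).aestronglyMeasurable measurableSet_Ioi) ?_
  refine (ae_restrict_iff' measurableSet_Ioi).2 (Eventually.of_forall fun u hu => ?_)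
  have hu1 : (1 : ℝ) < u := hu
  rw [norm_gammaIntegrand s a (by linarith)]
  exact mul_le_mul_of_nonneg_right
    (Real.rpow_le_rpow_of_exponent_le hu1.le (le_max_left _ _)) (Real.exp_pos _).le

theorem differentiableOn_integral_gammaIntegrand {s : ℝ} (hs : 0 < s) :
    DifferentiableOn ℂ (fun a : ℂ => ∫ u in Ioi (0 : ℝ), gammaIntegrand s a u)
      rightHalfPlane := by
  intro a ha
  have ha' : 0 < a.re := ha
  have hball : {z : ℂ | a.re / 2 < z.re} ∈ 𝓝 a :=
    (isOpen_lt continuous_const Complex.continuous_re).mem_nhds (by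
      simp only [mem_ofPred_eq]; linarith)
  have h := hasDerivAt_integral_of_dominated_loc_of_deriv_le
    (μ := volume.restrict (Ioi (0 : ℝ))) (F := fun a u => gammaIntegrand s a u) (x₀ := a)
    (F' := fun a u => -(u : ℂ) * gammaIntegrand s a u)
    (bound := fun u : ℝ => u ^ s * Real.exp (-(a.re / 2) * u)) hball
    (Eventually.of_forall fun z =>
      (continuousOn_gammaIntegrand s z).aestronglyMeasurable measurableSet_Ioi)
    (integrableOn_gammaIntegrand_Ioi_zero hs ha')
    ((Complex.continuous_ofReal.neg.continuousOn.mul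
      (continuousOn_gammaIntegrand s a)).aestronglyMeasurable measurableSet_Ioi)
    ?_ (integrableOn_rpow_mul_exp_neg (by linarith) (by linarith)) ?_
  · exact h.2.differentiableAt.differentiableWithinAt
  · refine (ae_restrict_iff' measurableSet_Ioi).2 (Eventually.of_forall fun u hu z hz => ?_)
    have hu0 : (0 : ℝ) < u := hu
    have hz' : a.re / 2 < z.re := hz
    rw [norm_mul, norm_gammaIntegrand s z hu0.le, norm_neg, Complex.norm_real,
      Real.norm_of_nonneg hu0.le, ← mul_assoc]
    have h1 : u * u ^ (s - 1) = u ^ s := by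
      rw [Real.rpow_sub_one hu0.ne']; field_simp
    rw [h1]
    refine mul_le_mul_of_nonneg_left (Real.exp_le_exp.2 ?_) (by positivity)
    exact mul_le_mul_of_nonneg_right (by linarith) hu0.le
  · refine Eventually.of_forall fun u z _ => ?_
    have h1 : HasDerivAt (fun a : ℂ => -a * (u : ℂ)) (-1 * u) z :=
      ((hasDerivAt_id z).neg).mul_const _
    refine (h1.cexp.const_mul ((u ^ (s - 1) : ℝ) : ℂ)).congr_deriv ?_
    rw [gammaIntegrand]
    ring

/-- Euler's integral for real a, carried to the half-plane by the identity theorem. -/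
theorem integral_gammaIntegrand_Ioi_zero {s : ℝ} (hs : 0 < s) {a : ℂ} (ha : 0 < a.re) :
    ∫ u in Ioi (0 : ℝ), gammaIntegrand s a u = Complex.Gamma s * a ^ (-(s : ℂ)) := by
  have hconv : IsPreconnected rightHalfPlane := (convex_halfSpace_re_gt 0).isPreconnected
  have hg : DifferentiableOn ℂ (fun a : ℂ => Complex.Gamma s * a ^ (-(s : ℂ))) rightHalfPlane :=
    (differentiableOn_cpow_neg (s : ℂ)).const_mul _
  have h1 : (1 : ℂ) ∈ rightHalfPlane := by simp [rightHalfPlane]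
  have hreal : ∀ r : ℝ, 0 < r → ∫ u in Ioi (0 : ℝ), gammaIntegrand s (r : ℂ) u
      = Complex.Gamma s * (r : ℂ) ^ (-(s : ℂ)) := by
    intro r hr
    have h := Complex.integral_cpow_mul_exp_neg_mul_Ioi (a := s) (by simpa using hs) hr
    have h2 : (1 / (r : ℂ)) ^ (s : ℂ) = (r : ℂ) ^ (-(s : ℂ)) := by
      rw [one_div, Complex.inv_cpow _ _ (by
        rw [Complex.arg_ofReal_of_nonneg hr.le]; exact Real.pi_pos.ne), Complex.cpow_neg]
    rw [h2, mul_comm] at h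
    rw [← h]
    refine setIntegral_congr_fun measurableSet_Ioi fun u hu => ?_
    rw [gammaIntegrand, Complex.ofReal_cpow (le_of_lt hu)]
    push_cast
    rw [neg_mul]
  have hfreq : ∃ᶠ z in 𝓝[≠] (1 : ℂ), (∫ u in Ioi (0 : ℝ), gammaIntegrand s z u)
      = Complex.Gamma s * z ^ (-(s : ℂ)) := by
    have ht : Tendsto (fun r : ℝ => (r : ℂ)) (𝓝[≠] 1) (𝓝[≠] (1 : ℂ)) := by
      refine tendsto_nhdsWithin_of_tendsto_nhds_of_eventually_within _ ?_ ?_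
      · exact (Complex.continuous_ofReal.tendsto' 1 1 (by simp)).mono_left nhdsWithin_le_nhds
      · filter_upwards [self_mem_nhdsWithin] with r hr
        exact fun h => hr (Complex.ofReal_eq_one.1 h)
    refine ht.frequently (Eventually.frequently ?_)
    filter_upwards [nhdsWithin_le_nhds (Ioi_mem_nhds one_pos)] with r hr using hreal r hr
  exact ((differentiableOn_integral_gammaIntegrand hs).analyticOnNhd
    isOpen_rightHalfPlane).eqOn_of_preconnected_of_frequently_eq
    (hg.analyticOnNhd isOpen_rightHalfPlane) hconv h1 hfreq ha

/-- The `k`-th term `(-a) ^ k / (k! (s + k))` of the lower incomplete gamma series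
(zero if `s + k = 0`). -/
noncomputable def lowerGammaTerm (s : ℝ) (a : ℂ) (k : ℕ) : ℂ :=
  (-a) ^ k / (k.factorial : ℂ) * ((s + k : ℝ) : ℂ)⁻¹

theorem exists_inv_add_le (s : ℝ) : ∃ C : ℝ, 0 ≤ C ∧ ∀ k : ℕ, ‖((s + k : ℝ) : ℂ)⁻¹‖ ≤ C := by
  have h : Tendsto (fun k : ℕ => |(s + k)⁻¹|) atTop (𝓝 |0|) :=
    ((tendsto_inv_atTop_zero.comp
      (tendsto_atTop_add_const_left _ s tendsto_natCast_atTop_atTop)).abs)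
  obtain ⟨C, hC⟩ := h.bddAbove_range
  have hC' : ∀ k : ℕ, |(s + (k : ℝ))⁻¹| ≤ C := fun k => hC ⟨k, rfl⟩
  refine ⟨C, (abs_nonneg _).trans (hC' 0), fun k => ?_⟩
  rw [← Complex.ofReal_inv, Complex.norm_real]
  exact hC' k

theorem summable_lowerGammaTerm (s : ℝ) (a : ℂ) : Summable (lowerGammaTerm s a) := by
  obtain ⟨C, _, hC⟩ := exists_inv_add_le s
  refine Summable.of_norm_bounded ((Real.summable_pow_div_factorial ‖a‖).mul_right C) fun k => ?_
  rw [lowerGammaTerm, norm_mul, norm_div, norm_pow, norm_neg, Complex.norm_natCast]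
  exact mul_le_mul_of_nonneg_left (hC k) (by positivity)

theorem hasSum_neg_pow_div_factorial (a : ℂ) :
    HasSum (fun k : ℕ => (-a) ^ k / (k.factorial : ℂ)) (Complex.exp (-a)) := by
  rw [Complex.exp_eq_exp_ℂ]
  exact NormedSpace.expSeries_div_hasSum_exp (-a)

theorem hasSum_lowerGammaTerm {s : ℝ} (hs : 0 < s) (a : ℂ) :
    HasSum (lowerGammaTerm s a) (∫ u in (0 : ℝ)..1, gammaIntegrand s a u) := by
  have hI : IntervalIntegrable (fun u : ℝ => u ^ (s - 1)) volume 0 1 :=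
    intervalIntegral.intervalIntegrable_rpow' (by linarith)
  have hmeas : AEStronglyMeasurable (fun u : ℝ => ((u ^ (s - 1) : ℝ) : ℂ))
      (volume.restrict (uIoc 0 1)) := by
    refine Complex.continuous_ofReal.comp_aestronglyMeasurable ?_
    rw [uIoc_of_le zero_le_one]
    exact hI.1.aestronglyMeasurable
  have h := intervalIntegral.hasSum_integral_of_dominated_convergence (a := 0) (b := 1)
    (μ := volume)
    (F := fun (k : ℕ) (u : ℝ) => ((u ^ (s - 1) : ℝ) : ℂ) * ((-a * u) ^ k / (k.factorial : ℂ)))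
    (f := gammaIntegrand s a)
    (fun k u => u ^ (s - 1) * (‖a‖ ^ k / k.factorial))
    (fun k => hmeas.mul (by fun_prop)) ?_ ?_ ?_ ?_
  · refine h.congr_fun fun k => ?_
    have h2 : ∀ u ∈ uIoc (0 : ℝ) 1, ((u ^ (s - 1) : ℝ) : ℂ) * ((-a * u) ^ k / (k.factorial : ℂ))
        = ((-a) ^ k / (k.factorial : ℂ)) * ((u ^ (s + k - 1) : ℝ) : ℂ) := by
      intro u hu
      rw [uIoc_of_le zero_le_one] at hu
      have : u ^ (s + k - 1) = u ^ (s - 1) * u ^ k := by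
        rw [← Real.rpow_natCast, ← Real.rpow_add hu.1]; congr 1; ring
      rw [this, mul_pow]
      push_cast
      ring
    have hk : 0 < s + k := by positivity
    symm
    rw [intervalIntegral.integral_congr_ae (Eventually.of_forall h2),
      intervalIntegral.integral_const_mul, intervalIntegral.integral_ofReal,
      integral_rpow (Or.inl (by linarith)), lowerGammaTerm, sub_add_cancel, Real.one_rpow,
      Real.zero_rpow hk.ne', sub_zero, one_div, Complex.ofReal_inv]
  · intro k
    refine Eventually.of_forall fun u hu => ?_
    rw [uIoc_of_le zero_le_one] at hu
    have := Real.rpow_nonneg hu.1.le (s - 1)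
    rw [norm_mul, norm_div, norm_pow, norm_mul, norm_neg, Complex.norm_natCast, Complex.norm_real,
      Complex.norm_real, Real.norm_of_nonneg hu.1.le, Real.norm_of_nonneg this]
    refine mul_le_mul_of_nonneg_left ?_ this
    have h0 : 0 ≤ ‖a‖ * u := mul_nonneg (norm_nonneg _) hu.1.le
    gcongr
    exact mul_le_of_le_one_right (norm_nonneg _) hu.2
  · exact Eventually.of_forall fun u _ => (Real.summable_pow_div_factorial ‖a‖).mul_left _
  · simp_rw [tsum_mul_left]
    exact hI.mul_const _
  · refine Eventually.of_forall fun u _ => ?_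
    have := (hasSum_neg_pow_div_factorial (a * u)).mul_left ((u ^ (s - 1) : ℝ) : ℂ)
    simpa only [gammaIntegrand, neg_mul] using this

/-- The upper incomplete gamma integral `∫_1^∞ u ^ (s - 1) exp (-a u) du`. -/
noncomputable def upperGamma (s : ℝ) (a : ℂ) : ℂ := ∫ u in Ioi (1 : ℝ), gammaIntegrand s a u

theorem upperGamma_add_tsum_of_pos {s : ℝ} (hs : 0 < s) {a : ℂ} (ha : 0 < a.re) :
    upperGamma s a + ∑' k, lowerGammaTerm s a k = Complex.Gamma s * a ^ (-(s : ℂ)) := by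
  rw [(hasSum_lowerGammaTerm hs a).tsum_eq, ← integral_gammaIntegrand_Ioi_zero hs ha, upperGamma,
    intervalIntegral.integral_of_le zero_le_one, add_comm,
    ← setIntegral_union Ioc_disjoint_Ioi_same measurableSet_Ioi
      ((integrableOn_gammaIntegrand_Ioi_zero hs ha).mono_set Ioc_subset_Ioi_self)
      (integrableOn_gammaIntegrand_Ioi_one s ha), Ioc_union_Ioi_eq_Ioi zero_le_one]

/-- Integration by parts; this recursion gives access to s ≤ 0. -/
theorem mul_upperGamma (s : ℝ) {a : ℂ} (ha : 0 < a.re) :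
    s * upperGamma s a = a * upperGamma (s + 1) a - Complex.exp (-a) := by
  have hd : ∀ u ∈ Ici (1 : ℝ), HasDerivAt (gammaIntegrand (s + 1) a)
      (s * gammaIntegrand s a u - a * gammaIntegrand (s + 1) a u) u := by
    intro u hu
    have hu0 : (0 : ℝ) < u := lt_of_lt_of_le one_pos hu
    have h1 := (Real.hasDerivAt_rpow_const (x := u) (p := s + 1 - 1) (Or.inl hu0.ne')).ofReal_comp
    have h2 : HasDerivAt (fun u : ℝ => -a * (u : ℂ)) (-a * 1) u :=
      (Complex.ofRealCLM.hasDerivAt (x := u)).const_mul _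
    refine (h1.mul h2.cexp).congr_deriv ?_
    simp only [gammaIntegrand, add_sub_cancel_right]
    push_cast
    ring
  have hi1 := (integrableOn_gammaIntegrand_Ioi_one s ha).const_mul (s : ℂ)
  have hi2 := (integrableOn_gammaIntegrand_Ioi_one (s + 1) ha).const_mul a
  have ht : Tendsto (gammaIntegrand (s + 1) a) atTop (𝓝 0) := by
    rw [tendsto_zero_iff_norm_tendsto_zero]
    refine (tendsto_rpow_mul_exp_neg_mul_atTop_nhds_zero (s + 1 - 1) a.re ha).congr' ?_
    filter_upwards [eventually_ge_atTop 0] with u hu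
    rw [norm_gammaIntegrand _ _ hu]
  have h := integral_Ioi_of_hasDerivAt_of_tendsto' hd (hi1.sub hi2) ht
  rw [integral_sub hi1 hi2, integral_const_mul, integral_const_mul] at h
  have h1 : gammaIntegrand (s + 1) a 1 = Complex.exp (-a) := by simp [gammaIntegrand]
  rw [h1] at h
  rw [upperGamma, upperGamma]
  linear_combination h

/-- Termwise s/(s+k) = 1 - k/(s+k). `D` is the resonant term k = -s, if any, where the inverse takes
the value 0. -/
theorem mul_tsum_lowerGammaTerm (s : ℝ) (a : ℂ) {D : ℂ}
    (hD : HasSum (fun k : ℕ => if s + k = 0 then (-a) ^ k / (k.factorial : ℂ) else 0) D) :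
    s * ∑' k, lowerGammaTerm s a k
      = Complex.exp (-a) + a * ∑' k, lowerGammaTerm (s + 1) a k - D := by
  have h1 := ((hasSum_neg_pow_div_factorial a).sub
    ((summable_lowerGammaTerm s a).hasSum.mul_left (s : ℂ))).sub hD
  have h2 := (hasSum_nat_add_iff' 1).2 h1
  have h3 := (summable_lowerGammaTerm (s + 1) a).hasSum.mul_left (-a)
  have h4 := h2.unique (h3.congr_fun fun k => ?_)
  · have h0 : (-a) ^ 0 / ((0 : ℕ).factorial : ℂ) - s * lowerGammaTerm s a 0
        - (if s + (0 : ℕ) = 0 then (-a) ^ 0 / ((0 : ℕ).factorial : ℂ) else 0) = 0 := by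
      by_cases hs : s = 0
      · simp [hs, lowerGammaTerm]
      · have : (s : ℂ) ≠ 0 := by exact_mod_cast hs
        simp [hs, lowerGammaTerm, this]
    rw [Finset.sum_range_one, h0] at h4
    linear_combination -h4
  · have hk : (k.factorial : ℂ) ≠ 0 := by exact_mod_cast k.factorial_ne_zero
    have hk' : (k : ℂ) + 1 ≠ 0 := by exact_mod_cast k.succ_ne_zero
    have hcast : (s + 1 : ℝ) + (k : ℝ) = s + (k + 1 : ℕ) := by push_cast; ring
    rw [lowerGammaTerm, lowerGammaTerm, hcast, Nat.factorial_succ]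
    by_cases hs : s + (k + 1 : ℕ) = 0
    · rw [hs, if_pos rfl]
      simp
    · have hs' : (s : ℂ) + ((k : ℂ) + 1) ≠ 0 := by exact_mod_cast hs
      rw [if_neg hs]
      push_cast
      field_simp
      ring

/-- In the two recursions exp(-a) cancels, leaving the functional equation of Γ(s) a^(-s); descend
from s > 0. -/
theorem upperGamma_add_tsum_of_ne {s : ℝ} (hs : ∀ M : ℕ, s + M ≠ 0) {a : ℂ} (ha : 0 < a.re) :
    upperGamma s a + ∑' k, lowerGammaTerm s a k = Complex.Gamma s * a ^ (-(s : ℂ)) := by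
  have key : ∀ n : ℕ, ∀ s : ℝ, (∀ M : ℕ, s + M ≠ 0) → 0 < s + n →
      upperGamma s a + ∑' k, lowerGammaTerm s a k = Complex.Gamma s * a ^ (-(s : ℂ)) := by
    intro n
    induction n with
    | zero => exact fun s _ hn => upperGamma_add_tsum_of_pos (by simpa using hn) ha
    | succ n ih =>
      intro s hs hn
      have h1 := ih (s + 1) (fun M => by
        have := hs (M + 1)
        push_cast at this
        rwa [add_assoc, add_comm 1]) (by push_cast at hn; linarith)
      have h2 := mul_tsum_lowerGammaTerm s a (D := 0) (by simp [hs])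
      have h3 := mul_upperGamma s ha
      have hs0 : (s : ℂ) ≠ 0 := by
        have := hs 0
        simpa using this
      have ha0 : a ≠ 0 := by rintro rfl; simp at ha
      have h4 : a * a ^ (-((s + 1 : ℝ) : ℂ)) = a ^ (-(s : ℂ)) := by
        nth_rw 1 [← Complex.cpow_one a]
        rw [← Complex.cpow_add _ _ ha0]
        congr 1
        push_cast
        ring
      refine mul_left_cancel₀ hs0 ?_
      have h5 : Complex.Gamma ((s + 1 : ℝ) : ℂ) = s * Complex.Gamma s := by
        push_cast
        exact Complex.Gamma_add_one _ hs0
      rw [← h4]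
      rw [h5] at h1
      linear_combination h3 + h2 + a * h1
  obtain ⟨n, hn⟩ := exists_nat_gt (-s)
  exact key n s hs (by linarith)

theorem tendsto_upperGamma_zero {a : ℂ} (ha : 0 < a.re) :
    Tendsto (fun s : ℝ => upperGamma s a) (𝓝[>] 0) (𝓝 (upperGamma 0 a)) := by
  have h01 : Ioi (1 : ℝ) ⊆ Ioi 0 := Ioi_subset_Ioi zero_le_one
  refine tendsto_integral_filter_of_dominated_convergence (fun u => Real.exp (-a.re * u))
    (Eventually.of_forall fun s => ((continuousOn_gammaIntegrand s a).mono
      h01).aestronglyMeasurable measurableSet_Ioi) ?_ ?_ ?_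
  · filter_upwards [nhdsWithin_le_nhds (Iio_mem_nhds one_pos)] with s hs
    refine (ae_restrict_iff' measurableSet_Ioi).2 (Eventually.of_forall fun u hu => ?_)
    have hu1 : (1 : ℝ) < u := hu
    have hs1 : s < 1 := hs
    rw [norm_gammaIntegrand s a (by linarith)]
    exact mul_le_of_le_one_left (Real.exp_pos _).le
      (Real.rpow_le_one_of_one_le_of_nonpos hu1.le (by linarith))
  · have h := (integrableOn_rpow_mul_exp_neg (r := 0) (by norm_num) ha).mono_set h01
    simp only [Real.rpow_zero, one_mul] at h
    exact h
  · refine (ae_restrict_iff' measurableSet_Ioi).2 (Eventually.of_forall fun u hu => ?_)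
    have hu0 : (0 : ℝ) < u := h01 hu
    have h : Continuous fun s : ℝ => gammaIntegrand s a u := by
      have : Continuous fun s : ℝ => u ^ (s - 1) :=
        (Real.continuous_const_rpow hu0.ne').comp (continuous_id.sub continuous_const)
      unfold gammaIntegrand
      fun_prop
    exact (h.tendsto 0).mono_left nhdsWithin_le_nhds

theorem tendsto_tsum_lowerGammaTerm_succ_zero (a : ℂ) :
    Tendsto (fun s : ℝ => ∑' k, lowerGammaTerm s a (k + 1)) (𝓝[>] 0)
      (𝓝 (∑' k, lowerGammaTerm 0 a (k + 1))) := by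
  refine tendsto_tsum_of_dominated_convergence
    (bound := fun k : ℕ => ‖a‖ ^ (k + 1) / (k + 1).factorial)
    ((summable_nat_add_iff 1).2 (Real.summable_pow_div_factorial ‖a‖)) (fun k => ?_) ?_
  · have h : ContinuousAt (fun s : ℝ => lowerGammaTerm s a (k + 1)) 0 := by
      unfold lowerGammaTerm
      refine continuousAt_const.mul (ContinuousAt.inv₀ (by fun_prop) ?_)
      rw [zero_add]
      exact_mod_cast k.succ_ne_zero
    exact h.tendsto.mono_left nhdsWithin_le_nhds
  · filter_upwards [self_mem_nhdsWithin] with s hs k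
    have hs0 : (0 : ℝ) < s := hs
    rw [lowerGammaTerm, norm_mul, norm_div, norm_pow, norm_neg, Complex.norm_natCast, norm_inv,
      Complex.norm_real, Real.norm_of_nonneg (by positivity)]
    refine mul_le_of_le_one_right (by positivity) (inv_le_one_of_one_le₀ ?_)
    push_cast
    linarith [k.cast_nonneg (α := ℝ)]

/-- Without its term 1/s, the identity for s > 0 reads (Γ(s+1) a^(-s) - 1)/s on the right. As s → 0+
this tends to the derivative of Γ(s+1) a^(-s) at 0. -/
theorem upperGamma_zero_add_tsum {a : ℂ} (ha : 0 < a.re) :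
    upperGamma 0 a + ∑' k, lowerGammaTerm 0 a k = Complex.digamma 1 - Complex.log a := by
  have ha0 : a ≠ 0 := by rintro rfl; simp at ha
  have h1 := (tendsto_upperGamma_zero ha).add (tendsto_tsum_lowerGammaTerm_succ_zero a)
  have hG : HasDerivAt (fun s : ℂ => Complex.Gamma (s + 1) * a ^ (-s))
      (Complex.digamma 1 - Complex.log a) 0 := by
    have hg1 : HasDerivAt Complex.Gamma (-Real.eulerMascheroniConstant) ((0 : ℂ) + 1) := by
      rw [zero_add]; exact Complex.hasDerivAt_Gamma_one
    have hg2 := hg1.comp_add_const (0 : ℂ) 1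
    have hg3 : HasDerivAt (fun s : ℂ => a ^ (-s)) (a ^ (-(0 : ℂ)) * Complex.log a * (-1)) 0 :=
      (hasDerivAt_id (0 : ℂ)).neg.const_cpow (Or.inl ha0)
    refine (hg2.mul hg3).congr_deriv ?_
    simp [Complex.digamma_one, sub_eq_add_neg]
  have hG2 := (hasDerivAt_iff_tendsto_slope.1 hG)
  have ht : Tendsto (fun r : ℝ => (r : ℂ)) (𝓝[>] 0) (𝓝[≠] (0 : ℂ)) := by
    refine tendsto_nhdsWithin_of_tendsto_nhds_of_eventually_within _ ?_ ?_
    · exact (Complex.continuous_ofReal.tendsto' 0 0 (by simp)).mono_left nhdsWithin_le_nhds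
    · filter_upwards [self_mem_nhdsWithin] with r hr
      exact fun h => (ne_of_gt hr) (Complex.ofReal_eq_zero.1 h)
  have h2 := hG2.comp ht
  have h0 : ∑' k, lowerGammaTerm 0 a k = ∑' k, lowerGammaTerm 0 a (k + 1) := by
    rw [(summable_lowerGammaTerm 0 a).tsum_eq_zero_add]
    simp [lowerGammaTerm]
  rw [h0]
  refine tendsto_nhds_unique h1 (h2.congr' ?_)
  filter_upwards [self_mem_nhdsWithin] with s hs
  have hs0 : (0 : ℝ) < s := hs
  have hsc : (s : ℂ) ≠ 0 := by exact_mod_cast hs0.ne'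
  have h3 := upperGamma_add_tsum_of_pos hs0 ha
  rw [(summable_lowerGammaTerm s a).tsum_eq_zero_add] at h3
  have h4 : lowerGammaTerm s a 0 = (s : ℂ)⁻¹ := by simp [lowerGammaTerm]
  rw [h4] at h3
  simp only [Function.comp, slope_def_field, sub_zero, zero_add, Complex.Gamma_one, neg_zero,
    Complex.cpow_zero, mul_one]
  rw [Complex.Gamma_add_one _ hsc]
  field_simp
  field_simp at h3
  linear_combination -h3

/-- At each step the resonant term supplies the 1/(M+1) in ψ(M+2) = ψ(M+1) + 1/(M+1). -/
theorem upperGamma_neg_nat_add_tsum (M : ℕ) {a : ℂ} (ha : 0 < a.re) :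
    upperGamma (-M) a + ∑' k, lowerGammaTerm (-M) a k
      = (-a) ^ M / (M.factorial : ℂ) * (Complex.digamma (M + 1) - Complex.log a) := by
  induction M with
  | zero => simpa using upperGamma_zero_add_tsum ha
  | succ M ih =>
    have hD : HasSum (fun k : ℕ => if (-((M + 1 : ℕ) : ℝ)) + k = 0
        then (-a) ^ k / (k.factorial : ℂ) else 0)
        ((-a) ^ (M + 1) / ((M + 1).factorial : ℂ)) := by
      convert hasSum_ite_eq (M + 1) ((-a) ^ (M + 1) / ((M + 1).factorial : ℂ)) using 2 with k
      have : (-((M + 1 : ℕ) : ℝ)) + k = 0 ↔ k = M + 1 := by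
        rw [neg_add_eq_zero, eq_comm]; exact_mod_cast Iff.rfl
      by_cases hk : k = M + 1
      · subst hk; simp
      · rw [if_neg (this.not.2 hk), if_neg hk]
    have h2 := mul_tsum_lowerGammaTerm (-((M + 1 : ℕ) : ℝ)) a hD
    have h3 := mul_upperGamma (-((M + 1 : ℕ) : ℝ)) ha
    have hs : (-((M + 1 : ℕ) : ℝ)) + 1 = -(M : ℝ) := by push_cast; ring
    rw [hs] at h2 h3
    have hM : (M : ℂ) + 1 ≠ 0 := by exact_mod_cast M.succ_ne_zero
    have hM' : (M.factorial : ℂ) ≠ 0 := by exact_mod_cast M.factorial_ne_zero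
    have hψ := Complex.digamma_apply_add_one ((M : ℂ) + 1) fun m h => by
      have : ((M + 1 + m : ℕ) : ℂ) = 0 := by push_cast; linear_combination h
      exact absurd (Nat.cast_eq_zero.1 this) (by omega)
    have hcast : ((-((M + 1 : ℕ) : ℝ) : ℝ) : ℂ) = -((M : ℂ) + 1) := by push_cast; ring
    rw [hcast] at h2 h3
    refine mul_left_cancel₀ (neg_ne_zero.2 hM) ?_
    push_cast
    push_cast at h2 h3 hψ
    rw [mul_add, h3, h2, hψ, eq_sub_of_add_eq ih, Nat.factorial_succ]
    push_cast
    field_simp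
    ring

/-! ### Identification of `J` -/

/-- Substitution u = x^p. -/
theorem tailIntegral_eq {p : ℝ} (hp : 0 < p) (w : ℝ) (a : ℂ) :
    tailIntegral p w a = 1 / (p : ℂ) * upperGamma ((1 - w) / p) a := by
  have hpc : (p : ℂ) ≠ 0 := by exact_mod_cast hp.ne'
  have h := integral_comp_rpow_Ioi_of_pos' (g := gammaIntegrand ((1 - w) / p) a) hp zero_le_one
  rw [Real.one_rpow] at h
  rw [upperGamma, ← h, tailIntegral, ← integral_const_mul]
  refine setIntegral_congr_fun measurableSet_Ioi fun x hx => ?_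
  have hx0 : (0 : ℝ) < x := lt_trans one_pos hx
  have h1 : x ^ (p - 1) * (x ^ p) ^ ((1 - w) / p - 1) = (x ^ w)⁻¹ := by
    rw [← Real.rpow_mul hx0.le, ← Real.rpow_add hx0, ← Real.rpow_neg hx0.le]
    congr 1
    field_simp
    ring
  simp only [gammaIntegrand, Complex.real_smul]
  rw [expFun_ofReal p w a hx0.le, div_eq_mul_inv, ← Complex.ofReal_inv, ← h1]
  push_cast
  field_simp

/-- The difference between the `k`-th coefficient term formed with `riemannZeta₀`
and the `k`-th primed term. -/
noncomputable def corrTerm (p w : ℝ) (a : ℂ) (k : ℕ) : ℂ :=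
  1 / (p : ℂ) * lowerGammaTerm ((1 - w) / p) a k
    + if w = p * k + 1 then (-a) ^ k / (k.factorial : ℂ) * Real.eulerMascheroniConstant else 0

/-- With s = w - kp, the polar part -1/(s-1) equals 1/p divided by (1-w)/p + k, a lower incomplete
gamma coefficient. At s = 1 only ζ₀(1) = γ remains. -/
theorem mul_riemannZeta₀_eq {p : ℝ} (hp : 0 < p) (w : ℝ) (a : ℂ) (k : ℕ) :
    (-a) ^ k / (k.factorial : ℂ) * riemannZeta₀ ((w - k * p : ℝ) : ℂ)
      = primedTerm p w a k + corrTerm p w a k := by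
  have hpc : (p : ℂ) ≠ 0 := by exact_mod_cast hp.ne'
  by_cases h : w = p * k + 1
  · have h1 : w - k * p = 1 := by rw [h]; ring
    have h2 : (1 - w) / p + k = 0 := by rw [h]; field_simp; ring
    rw [primedTerm, corrTerm, lowerGammaTerm, if_pos h, if_pos h, h1, h2]
    simp
  · have h1 : w - k * p ≠ 1 := fun h1 => h (by linarith)
    have h1c : ((w - k * p : ℝ) : ℂ) ≠ 1 := fun h0 => h1 (Complex.ofReal_eq_one.1 h0)
    have h3 : (((1 - w) / p + k : ℝ) : ℂ)⁻¹ = -(p * (((w - k * p : ℝ) : ℂ) - 1)⁻¹) := by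
      have : (((1 - w) / p + k : ℝ) : ℂ) = -((((w - k * p : ℝ) : ℂ) - 1) / p) := by
        push_cast
        field_simp
        ring
      rw [this, inv_neg, inv_div, div_eq_mul_inv]
    rw [primedTerm, corrTerm, lowerGammaTerm, if_neg h, if_neg h,
      riemannZeta_eq_inv_sub_add h1c, h3, neg_pow a]
    field_simp
    ring

theorem summable_corrTerm (p w : ℝ) (a : ℂ) (hp : 0 < p) : Summable (corrTerm p w a) := by
  refine ((summable_lowerGammaTerm ((1 - w) / p) a).mul_left _).add ?_
  refine summable_of_hasFiniteSupport (Set.Finite.subset (s := {k : ℕ | w = p * k + 1}) ?_ ?_)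
  · refine Set.Subsingleton.finite fun k hk l hl => ?_
    have : p * (k : ℝ) = p * l := by
      have h1 : w = p * k + 1 := hk
      have h2 : w = p * l + 1 := hl
      linarith
    exact_mod_cast mul_left_cancel₀ hp.ne' this
  · intro k hk
    by_contra h
    have h' : ¬ w = p * k + 1 := h
    exact hk (if_neg h')

theorem tailIntegral_add_tsum_corrTerm {p : ℝ} (hp : 0 < p) (w : ℝ) {a : ℂ} (ha : 0 < a.re) :
    tailIntegral p w a + ∑' k, corrTerm p w a k = J p a w := by
  have hpc : (p : ℂ) ≠ 0 := by exact_mod_cast hp.ne'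
  have hs := ((summable_lowerGammaTerm ((1 - w) / p) a).hasSum.mul_left (1 / (p : ℂ)))
  rw [tailIntegral_eq hp]
  by_cases h : ∃ M : ℕ, w = p * M + 1
  · obtain ⟨M, hM⟩ := h
    have h1 : HasSum (fun k : ℕ => if w = p * k + 1 then
        (-a) ^ k / (k.factorial : ℂ) * (Real.eulerMascheroniConstant : ℂ) else 0)
        ((-a) ^ M / (M.factorial : ℂ) * (Real.eulerMascheroniConstant : ℂ)) := by
      refine (hasSum_ite_eq M _).congr_fun fun k => ?_
      by_cases hk : k = M
      · subst hk; rw [if_pos hM, if_pos rfl]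
      · rw [if_neg hk, if_neg fun h => hk ?_]
        have : p * (k : ℝ) = p * M := by linarith
        exact_mod_cast mul_left_cancel₀ hp.ne' this
    have h2 : (1 - w) / p = -(M : ℝ) := by rw [hM]; field_simp; ring
    have h3 := upperGamma_neg_nat_add_tsum M ha
    have h4 : ∑' k, corrTerm p w a k = 1 / (p : ℂ) * ∑' k, lowerGammaTerm ((1 - w) / p) a k
        + (-a) ^ M / (M.factorial : ℂ) * (Real.eulerMascheroniConstant : ℂ) :=
      (hs.add h1).tsum_eq
    rw [J_of_eq hp.ne' a hM, logTerm, h4, h2]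
    linear_combination 1 / (p : ℂ) * h3
  · push Not at h
    have h1 : ∀ M : ℕ, (1 - w) / p + M ≠ 0 := fun M h0 => h M (by
      field_simp at h0
      linarith)
    have h3 := upperGamma_add_tsum_of_ne h1 ha
    have h4 : ∑' k, corrTerm p w a k = 1 / (p : ℂ) * ∑' k, lowerGammaTerm ((1 - w) / p) a k := by
      rw [← hs.tsum_eq]
      exact tsum_congr fun k => by rw [corrTerm, if_neg (h k), add_zero]
    have h5 : (((w - 1) / p : ℝ) : ℂ) = -(((1 - w) / p : ℝ) : ℂ) := by
      push_cast
      ring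
    rw [J_of_ne a h, powerTerm, h4, h5]
    linear_combination 1 / (p : ℂ) * h3

theorem exists_norm_tsum_corrTerm_sub_le {p : ℝ} (hp : 0 < p) (w : ℝ) (N : ℕ) :
    ∃ C : ℝ, ∀ a : ℂ, ‖a‖ ≤ 1 →
      ‖∑' k, corrTerm p w a k - ∑ k ∈ Finset.range N, corrTerm p w a k‖ ≤ C * ‖a‖ ^ N := by
  obtain ⟨C, hC0, hC⟩ := exists_inv_add_le ((1 - w) / p)
  set D : ℝ := 1 / p * C + |Real.eulerMascheroniConstant| with hD
  refine ⟨∑' k : ℕ, D * ((k + N).factorial : ℝ)⁻¹, fun a ha => ?_⟩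
  have hbound : ∀ k, ‖corrTerm p w a k‖ ≤ D * (‖a‖ ^ k / k.factorial) := by
    intro k
    have hn : ‖(-a) ^ k / (k.factorial : ℂ)‖ = ‖a‖ ^ k / k.factorial := by
      rw [norm_div, norm_pow, norm_neg, Complex.norm_natCast]
    rw [corrTerm, lowerGammaTerm, hD, add_mul]
    refine (norm_add_le _ _).trans (add_le_add ?_ ?_)
    · rw [norm_mul, norm_mul, hn, norm_div, norm_one, Complex.norm_real, Real.norm_of_nonneg hp.le,
        mul_assoc, mul_comm C]
      gcongr
      exact hC k
    · split_ifs
      · rw [norm_mul, hn, Complex.norm_real, Real.norm_eq_abs, mul_comm]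
      · rw [norm_zero]; positivity
  have hsum : Summable fun k : ℕ => ((k + N).factorial : ℝ)⁻¹ := by
    have := (summable_nat_add_iff N).2 (Real.summable_pow_div_factorial 1)
    simpa using this
  rw [← (summable_corrTerm p w a hp).sum_add_tsum_nat_add N, add_sub_cancel_left, ← tsum_mul_right]
  refine tsum_of_norm_bounded ((hsum.mul_left D).mul_right _).hasSum fun k => (hbound _).trans ?_
  have hD0 : 0 ≤ D := by positivity
  rw [mul_assoc]
  refine mul_le_mul_of_nonneg_left ?_ hD0
  rw [div_eq_inv_mul]
  refine mul_le_mul_of_nonneg_left ?_ (by positivity)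
  exact pow_le_pow_of_le_one (norm_nonneg _) ha (by omega)

theorem re_pos_of_abs_arg_lt {a : ℂ} (ha : a ≠ 0) (harg : |a.arg| < Real.pi / 2) : 0 < a.re :=
  (Complex.abs_arg_lt_pi_div_two_iff.1 harg).resolve_right ha

/-! ### The asymptotic expansion -/

/-- Uniformity in the sector comes from ρ depending only on p and θ. -/
theorem isBigO_S_sub {p w : ℝ} (hp : 0 < p) (hw : 0 < w) (N : ℕ) {θ : ℝ}
    (hθ : θ < Real.pi / 2) :
    (fun a : ℂ => S p a w - (J p a w + ∑ k ∈ Finset.range N, primedTerm p w a k))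
      =O[𝓝[closedSector θ] 0] fun a : ℂ => ‖a‖ ^ N := by
  obtain ⟨ρ, hρ0, hρ, hcone⟩ := exists_cone_re_nonneg hp hθ
  obtain ⟨C, hC⟩ := exists_norm_tsum_corrTerm_sub_le hp w N
  obtain ⟨m, hm⟩ := exists_nat_ge (1 - (w - p * N))
  set E : ℝ := (m + 3) * ((m + 1).factorial * (2 ^ |p * N - w| * (1 / N.factorial))
          / ρ ^ (m + 1)) with hE
  refine IsBigO.of_bound (E + C) ?_
  have hball : Metric.closedBall (0 : ℂ) 1 ∈ 𝓝 (0 : ℂ) := Metric.closedBall_mem_nhds _ one_pos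
  filter_upwards [self_mem_nhdsWithin, nhdsWithin_le_nhds hball] with a ha ha1
  have ha1' : ‖a‖ ≤ 1 := by simpa using ha1
  have hre := re_pos_of_abs_arg_lt ha.1 (ha.2.trans_lt hθ)
  have h1 := norm_S_sub_le hp hw hre hρ0 hρ (hcone a ha.1 ha.2) (N := N) (m := m) (by linarith)
  have h2 := hC a ha1'
  have h3 : S p a w - (J p a w + ∑ k ∈ Finset.range N, primedTerm p w a k)
      = (S p a w - tailIntegral p w a - ∑ k ∈ Finset.range N,
          ((-a) ^ k / (k.factorial : ℂ)) * riemannZeta₀ ((w - k * p : ℝ) : ℂ))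
        - (∑' k, corrTerm p w a k - ∑ k ∈ Finset.range N, corrTerm p w a k) := by
    rw [Finset.sum_congr rfl fun k _ => mul_riemannZeta₀_eq hp w a k, Finset.sum_add_distrib,
      ← tailIntegral_add_tsum_corrTerm hp w hre]
    ring
  rw [h3, norm_pow, norm_norm, add_mul]
  refine (norm_sub_le _ _).trans (add_le_add (h1.trans_eq ?_) h2)
  rw [hE]
  ring

/-! ### The convergent expansion -/

/-- With m = ⌈pN⌉ + 1, divisibility of factorials gives (m+1)!/N! ≤ 1/l! for l = N - m - 1, which is
at least (1-p)N - 3. All other factors grow at most geometrically in N. -/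
theorem tendsto_error_bound {p : ℝ} (hp : 0 < p) (hp1 : p < 1) {w A ρ : ℝ} (hw : 0 < w)
    (hA : 0 ≤ A) (hρ0 : 0 < ρ) (hρ1 : ρ < 1) :
    Tendsto (fun N : ℕ => (((⌈p * N⌉₊ + 1 : ℕ) : ℝ) + 3) * ((⌈p * N⌉₊ + 1 + 1).factorial *
      (2 ^ |p * N - w| * (A ^ N / N.factorial)) / ρ ^ (⌈p * N⌉₊ + 1 + 1))) atTop (𝓝 0) := by
  -- This q gives N ≤ q(l + 3), so G^N ≤ (G^q)^(l+3), which l! beats.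
  obtain ⟨q, hq⟩ := exists_nat_ge (1 / (1 - p))
  have hq' : 1 ≤ q * (1 - p) := by rwa [div_le_iff₀ (by linarith)] at hq
  -- The 4 collects one 2^N from m + 3 and one from 2^|pN-w|.
  set G : ℝ := max 1 (4 * A / ρ) with hG
  have hG1 : 1 ≤ G := le_max_left _ _
  set l : ℕ → ℕ := fun N => N - (⌈p * N⌉₊ + 1 + 1) with hl
  have hceil : ∀ N : ℕ, (⌈p * N⌉₊ : ℝ) < p * N + 1 := fun N => Nat.ceil_lt_add_one (by positivity)
  have hlow : ∀ N : ℕ, (1 - p) * N - 3 ≤ l N := by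
    intro N
    have h1 : (N : ℝ) ≤ l N + (⌈p * N⌉₊ + 1 + 1) := by
      have : N ≤ l N + (⌈p * N⌉₊ + 1 + 1) := by simp only [hl]; omega
      exact_mod_cast this
    linarith [hceil N]
  have hNl : ∀ N : ℕ, N ≤ q * (l N + 3) := by
    intro N
    have h1 : (N : ℝ) ≤ q * (l N + 3) := by
      calc (N : ℝ) ≤ (q * (1 - p)) * N := le_mul_of_one_le_left (by positivity) hq'
        _ = q * ((1 - p) * N) := by ring
        _ ≤ q * (l N + 3) := mul_le_mul_of_nonneg_left (by linarith [hlow N]) (by positivity)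
    exact_mod_cast h1
  have hlt : Tendsto l atTop atTop := by
    rw [← tendsto_natCast_atTop_iff (R := ℝ)]
    refine tendsto_atTop_mono hlow ?_
    exact tendsto_atTop_add_const_right _ _
      (Tendsto.const_mul_atTop (by linarith) tendsto_natCast_atTop_atTop)
  have hlim := ((FloorSemiring.tendsto_pow_div_factorial_atTop (G ^ q)).comp hlt).const_mul
    (4 * 2 ^ w * (G ^ q) ^ 3)
  rw [mul_zero] at hlim
  have hlarge : ∀ᶠ N : ℕ in atTop, 3 ≤ (1 - p) * N :=
    (Tendsto.const_mul_atTop (by linarith) tendsto_natCast_atTop_atTop).eventually_ge_atTop 3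
  refine squeeze_zero' (Eventually.of_forall fun N => by positivity) ?_ hlim
  filter_upwards [hlarge] with N hN
  have hMN : ⌈p * N⌉₊ + 1 + 1 ≤ N := by
    have : (⌈p * N⌉₊ : ℝ) + 1 < N := by linarith [hceil N]
    have h' : ⌈p * N⌉₊ + 1 < N := by exact_mod_cast this
    omega
  set M : ℕ := ⌈p * N⌉₊ + 1 with hM
  have hfac : ((M + 1).factorial : ℝ) * (l N).factorial ≤ N.factorial := by
    have h := Nat.factorial_mul_factorial_dvd_factorial hMN
    exact_mod_cast Nat.le_of_dvd N.factorial_pos h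
  have h1 : (M : ℝ) + 3 ≤ 4 * 2 ^ N := by
    have h2 : (M : ℝ) + 1 ≤ N := by exact_mod_cast hMN
    have h3 : (N : ℝ) ≤ 2 ^ N := by exact_mod_cast Nat.lt_two_pow_self.le
    have h4 : (1 : ℝ) ≤ 2 ^ N := one_le_pow₀ (by norm_num)
    linarith
  have h2 : (2 : ℝ) ^ |p * N - w| ≤ 2 ^ N * 2 ^ w := by
    rw [← Real.rpow_natCast, ← Real.rpow_add (by norm_num)]
    refine Real.rpow_le_rpow_of_exponent_le (by norm_num) ?_
    have : p * N ≤ 1 * N := mul_le_mul_of_nonneg_right hp1.le (by positivity)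
    rw [abs_le]
    constructor <;> nlinarith [N.cast_nonneg (α := ℝ), mul_nonneg hp.le (N.cast_nonneg (α := ℝ))]
  have h3 : (ρ ^ (M + 1))⁻¹ ≤ (ρ ^ N)⁻¹ :=
    inv_anti₀ (by positivity) (pow_le_pow_of_le_one hρ0.le hρ1.le hMN)
  have h4 : ((M + 1).factorial : ℝ) / N.factorial ≤ ((l N).factorial : ℝ)⁻¹ := by
    rw [div_le_iff₀ (by positivity), le_inv_mul_iff₀ (by positivity), mul_comm]
    exact hfac
  have h5 : (4 * A / ρ) ^ N ≤ (G ^ q) ^ (l N + 3) := by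
    calc (4 * A / ρ) ^ N ≤ G ^ N := pow_le_pow_left₀ (by positivity) (le_max_right _ _) N
      _ ≤ G ^ (q * (l N + 3)) := pow_le_pow_right₀ hG1 (hNl N)
      _ = _ := pow_mul _ _ _
  calc ((M : ℝ) + 3) * ((M + 1).factorial * (2 ^ |p * N - w| * (A ^ N / N.factorial))
        / ρ ^ (M + 1))
      = ((M : ℝ) + 3) * (2 : ℝ) ^ |p * N - w| * (ρ ^ (M + 1))⁻¹ * A ^ N
          * ((M + 1).factorial / N.factorial) := by ring
    _ ≤ (4 * 2 ^ N) * (2 ^ N * 2 ^ w) * (ρ ^ N)⁻¹ * A ^ N * ((l N).factorial : ℝ)⁻¹ := by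
        gcongr
    _ = 4 * 2 ^ w * (4 * A / ρ) ^ N * ((l N).factorial : ℝ)⁻¹ := by
        have : (4 * A / ρ) ^ N = 2 ^ N * 2 ^ N * A ^ N * (ρ ^ N)⁻¹ := by
          rw [div_pow, mul_pow, ← mul_pow 2 2]
          norm_num
          ring
        rw [this]
        ring
    _ ≤ 4 * 2 ^ w * (G ^ q) ^ (l N + 3) * ((l N).factorial : ℝ)⁻¹ := by gcongr
    _ = _ := by
        simp only [Function.comp]
        ring

theorem tendsto_sum_mul_riemannZeta₀ {p w : ℝ} (hp : 0 < p) (hp1 : p < 1) (hw : 0 < w) {a : ℂ}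
    (ha : a ≠ 0) (harg : |a.arg| < Real.pi / 2) :
    Tendsto (fun N : ℕ => ∑ k ∈ Finset.range N,
      ((-a) ^ k / (k.factorial : ℂ)) * riemannZeta₀ ((w - k * p : ℝ) : ℂ)) atTop
      (𝓝 (S p a w - tailIntegral p w a)) := by
  obtain ⟨ρ, hρ0, hρ, hcone⟩ := exists_cone_re_nonneg hp harg
  have hre := re_pos_of_abs_arg_lt ha harg
  rw [tendsto_iff_norm_sub_tendsto_zero]
  refine squeeze_zero (fun _ => norm_nonneg _) (fun N => ?_)
    (tendsto_error_bound hp hp1 hw (norm_nonneg a) hρ0 (by linarith))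
  rw [norm_sub_rev]
  refine norm_S_sub_le hp hw hre hρ0 hρ (hcone a ha le_rfl) ?_
  have := Nat.le_ceil (p * N)
  push_cast
  linarith

/-- The partial sums already converge at the positive real point 2|a|, so the terms there are
bounded; the power series at a is then dominated by a geometric series of ratio 1/2. -/
theorem summable_mul_riemannZeta₀ {p w : ℝ} (hp : 0 < p) (hp1 : p < 1) (hw : 0 < w) {a : ℂ}
    (ha : a ≠ 0) :
    Summable fun k : ℕ =>
      ((-a) ^ k / (k.factorial : ℂ)) * riemannZeta₀ ((w - k * p : ℝ) : ℂ) := by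
  have hr : 0 < 2 * ‖a‖ := by positivity
  have h := tendsto_sum_mul_riemannZeta₀ hp hp1 hw (a := ((2 * ‖a‖ : ℝ) : ℂ))
    (by exact_mod_cast hr.ne') (by
      rw [Complex.arg_ofReal_of_nonneg hr.le, abs_zero]; positivity)
  have h0 := ((tendsto_add_atTop_iff_nat 1).2 h).sub h
  simp only [Finset.sum_range_succ, add_sub_cancel_left] at h0
  obtain ⟨C, hC⟩ := h0.norm.bddAbove_range
  have hC' : ∀ k : ℕ, ‖((-((2 * ‖a‖ : ℝ) : ℂ)) ^ k / (k.factorial : ℂ))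
      * riemannZeta₀ ((w - k * p : ℝ) : ℂ)‖ ≤ C := fun k => hC ⟨k, rfl⟩
  refine Summable.of_norm_bounded (summable_geometric_two.mul_left C) fun k => ?_
  refine le_trans (le_of_eq ?_) (mul_le_mul_of_nonneg_right (hC' k) (by positivity))
  have h2 : (2 : ℝ) ^ k * (1 / 2) ^ k = 1 := by rw [← mul_pow]; norm_num
  rw [norm_mul, norm_mul, norm_div, norm_div, norm_pow, norm_pow, norm_neg, norm_neg,
    Complex.norm_real, Real.norm_of_nonneg hr.le, mul_pow]
  linear_combination -(‖a‖ ^ k / ‖(k.factorial : ℂ)‖ * ‖riemannZeta₀ ((w - k * p : ℝ) : ℂ)‖) * h2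

theorem summable_primedTerm_and_S_eq {p w : ℝ} (hp : 0 < p) (hp1 : p < 1) (hw : 0 < w) {a : ℂ}
    (ha : a ≠ 0) (harg : |a.arg| < Real.pi / 2) :
    Summable (primedTerm p w a) ∧ S p a w = J p a w + ∑' k : ℕ, primedTerm p w a k := by
  have hre := re_pos_of_abs_arg_lt ha harg
  have h1 := summable_mul_riemannZeta₀ hp hp1 hw ha
  have h2 := summable_corrTerm p w a hp
  have heq : (fun k : ℕ => ((-a) ^ k / (k.factorial : ℂ)) * riemannZeta₀ ((w - k * p : ℝ) : ℂ)
      - corrTerm p w a k) = primedTerm p w a :=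
    funext fun k => by rw [mul_riemannZeta₀_eq hp, add_sub_cancel_right]
  have h3 := tendsto_nhds_unique h1.hasSum.tendsto_sum_nat
    (tendsto_sum_mul_riemannZeta₀ hp hp1 hw ha harg)
  have h4 := h1.hasSum.sub h2.hasSum
  rw [heq] at h4
  refine ⟨h4.summable, ?_⟩
  rw [h4.tsum_eq, h3, ← tailIntegral_add_tsum_corrTerm hp w hre]
  ring

end SmoothedZeta

theorem mainTheorem3 (p w : ℝ) (hw : 0 < w) :
    -- for `p > 1`: asymptotic expansion, uniformly in closed subsectors of `|arg a| < π/2`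
    (1 < p → ¬ (∃ m n : ℕ, w = 2 * m ∧ p = 2 * n) →
      ∀ N : ℕ, 0 < N → (w - 1) / p + 3 / 2 < N →
      ∀ θ : ℝ, θ < Real.pi / 2 →
        (fun a : ℂ => SmoothedZeta.S p a w
            - (SmoothedZeta.J p a w
                + ∑ k ∈ Finset.range N, SmoothedZeta.primedTerm p w a k))
          =O[𝓝[SmoothedZeta.closedSector θ] 0] fun a : ℂ => ‖a‖ ^ ((N : ℝ) - 1 / 2)) ∧
    -- for `0 < p < 1`: the primed series converges and the representation is exact
    (0 < p → p < 1 → ∀ a : ℂ, a ≠ 0 → |Complex.arg a| < Real.pi / 2 →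
      Summable (SmoothedZeta.primedTerm p w a) ∧
      SmoothedZeta.S p a w
        = SmoothedZeta.J p a w + ∑' k : ℕ, SmoothedZeta.primedTerm p w a k) := by
  refine ⟨fun hp _ N _ _ θ hθ => ?_, fun hp hp1 a ha harg =>
    SmoothedZeta.summable_primedTerm_and_S_eq hp hp1 hw ha harg⟩
  -- For |a| ≤ 1 the bound |a|^N is stronger than |a|^(N-1/2).
  refine (SmoothedZeta.isBigO_S_sub (by linarith) hw N hθ).trans (IsBigO.of_bound 1 ?_)
  have hball : Metric.closedBall (0 : ℂ) 1 ∈ 𝓝 (0 : ℂ) := Metric.closedBall_mem_nhds _ one_pos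
  filter_upwards [self_mem_nhdsWithin, nhdsWithin_le_nhds hball] with a ha ha1
  have ha0 : 0 < ‖a‖ := norm_pos_iff.2 ha.1
  have ha1' : ‖a‖ ≤ 1 := by simpa using ha1
  rw [one_mul, Real.norm_of_nonneg (by positivity), Real.norm_of_nonneg (by positivity),
    ← Real.rpow_natCast]
  exact Real.rpow_le_rpow_of_exponent_ge ha0 ha1' (by linarith)
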